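/- Let $\Gamma=(V,E)$ be a finite oriented graph (no loops, at most one edge between two vertices, each edge $e$ directed from $\mathrm o(e)$ to $\mathrm t(e)$). For $v\in V$ let $E_v^{\mathrm o}$ and $E_v^{\mathrm t}$ be the sets of edges with origin $v$ and with terminus $v$. Let $\mathcal H_v$ ($v\in V$), $\mathcal H_e$ ($e\in E$) and $\mathcal V_e\neq 0$ ($e\in E$) be finite-dimensional complex Hilbert spaces, and let $$A_v\in\bigotimes_{f\in E_v^{\mathrm o}}\mathcal V_f\otimes\mathcal H_v\otimes\bigotimes_{e\in E_v^{\mathrm t}}\mathcal V_e^{*}\qquad(v\in V)$$ be the tensors of a PEPS $|\Psi_\Gamma(A)\rangle$. For a subgraph $\Lambda\subseteq\Gamma$ let $\mathbb T_\Lambda(A)$ be the blocked tensor obtained by contracting the tensors $A_v$, $v\in\Lambda$, along the edges of $\Lambda$; $\Lambda$ is an *injective region* if $\mathbb T_\Lambda(A)$ is injective as a linear map from its uncontracted virtual legs to its physical legs $\bigotimes_{v\in\Lambda}\mathcal H_v$. Assume: * (normality) every vertex of $\Gamma$ lies in an injective region; * ($\Gamma$ is big enough) for every edge $e$ there are two injective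 regions without common vertices, one containing $\mathrm o(e)$ and the other containing $\mathrm t(e)$. Let $B_e\in\mathcal V_e\otimes\mathcal H_e\otimes\mathcal V_e^{*}$ ($e\in E$) be arbitrary unital edge tensors, i.e. for each $e$ there is $x\in\mathcal H_e^*$ whose contraction with the physical leg of $B_e$ is $\mathrm{id}_{\mathcal V_e}$. Write $B_e=\sum_k|k\rangle\otimes B_e^k$ with $B_e^k\in\operatorname{End}(\mathcal V_e)$, for a basis $|k\rangle$ of $\mathcal H_e$. Let $|\Psi_\Gamma(A,B)\rangle\in\bigotimes_{v}\mathcal H_v\otimes\bigotimes_e\mathcal H_e$ be the resulting gPEPS, i.e. the PEPS on the barycentric subdivision of $\Gamma$ with tensor $A_v$ at each $v\in V$ and $B_e$ at the midpoint of each $e\in E$; the second leg ($\mathcal V_e^*$) of $B_e$ is contracted along the half edge $e^{\mathrm o}$ from $\mathrm o(e)$ to $e$ and the first leg ($\mathcal V_e$) along the half edge $e^{\mathrm t}$ from $e$ to $\mathrm t(e)$, so $\mathcal V_{e^{\mathrm o}}=\mathcal V_{e^{\mathrm t}}=\mathcal V_e$. Let $G$ be a topological group (for instance a finite group or a compact Lie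 group), and let $U_v:G\to \mathrm{GL}(\mathcal H_v)$ and $L_e,R_e:G\to \mathrm{GL}(\mathcal H_e)$ be homomorphisms such that $|\Psi_\Gamma(A,B)\rangle$ is gauge-invariant: for all $v\in V$ and $g\in G$, $$\Big(\bigotimes_{e\in E_v^{\mathrm o}}R_e(g)\otimes U_v(g)\otimes\bigotimes_{e\in E_v^{\mathrm t}}L_e(g)\Big)|\Psi_\Gamma(A,B)\rangle=|\Psi_\Gamma(A,B)\rangle .$$ Then there are homomorphisms $V_{e^{\mathrm o}},V_{e^{\mathrm t}}:G\to \mathrm{GL}(\mathcal V_e)$, $e\in E$, such that, for all $g\in G$: 1. for every edge $e$ and every $k$, $$\sum_l L_e(g)_{kl}B_e^l=V_{e^{\mathrm t}}(g)^{-1}B_e^k,\qquad \sum_l R_e(g)_{kl}B_e^l=B_e^k\,V_{e^{\mathrm o}}(g);$$ 2. for every vertex $v$, $$U_v(g)\circ A_v=A_v\circ\Big(\bigotimes_{f\in E_v^{\mathrm o}}V_{f^{\mathrm o}}(g)^{-1}\otimes\bigotimes_{e\in E_v^{\mathrm t}}V_{e^{\mathrm t}}(g)\Big),$$ where $A_v$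 is viewed as a linear map $\bigotimes_{f\in E_v^{\mathrm o}}\mathcal V_f^{*}\otimes\bigotimes_{e\in E_v^{\mathrm t}}\mathcal V_e\to\mathcal H_v$ and an operator on $\mathcal V_f$ acts on $\mathcal V_f^*$ by its transpose. Moreover, $V_{e^{\mathrm t}}$ is continuous if $L_e$ is, and $V_{e^{\mathrm o}}$ is continuous if $R_e$ is. -/

import Mathlib

open Matrix
open scoped Kronecker

namespace GaugePEPS

/-- An oriented graph with vertex type `V` and edge type `E`: every edge `e` has an origin `o e` and
a terminus `t e`, is determined by the ordered pair `(o e, t e)`, and `(v₂, v₁)` is not an edge if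
`(v₁, v₂)` is one (in particular there are no loops). -/
structure OrientedGraph (V E : Type*) where
  o : E → V
  t : E → V
  edge_ext : ∀ e f, o e = o f → t e = t f → e = f
  oriented : ∀ e f, ¬ (o e = t f ∧ t e = o f)

/-- The barycentric subdivision.  Its vertices are the old vertices `Sum.inl v` and the old edges
`Sum.inr e`; its edges are the half edges `eᵒ = Sum.inl e`, which goes from `o e` to `e`, and
`eᵗ = Sum.inr e`, which goes from `e` to `t e`. -/
def OrientedGraph.bary {V E : Type*} (Γ : OrientedGraph V E) : OrientedGraph (V ⊕ E) (E ⊕ E) where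
  o := Sum.elim (fun e => Sum.inl (Γ.o e)) Sum.inr
  t := Sum.elim Sum.inr (fun e => Sum.inl (Γ.t e))
  edge_ext := by
    rintro (e | e) (f | f) <;> simp
    exact fun h _ => h
  oriented := by
    rintro (e | e) (f | f) <;> simp
    · intro h h'
      subst h'
      exact Γ.oriented e e ⟨h, h.symm⟩
    · intro h h'
      subst h
      exact Γ.oriented e e ⟨h'.symm, h'⟩

/-- A subgraph: a set of vertices and a set of edges whose endpoints are among these vertices. -/
structure Subgraph {V E : Type*} (Γ : OrientedGraph V E) where
  verts : Finset V
  edges : Finset E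
  o_mem : ∀ e ∈ edges, Γ.o e ∈ verts
  t_mem : ∀ e ∈ edges, Γ.t e ∈ verts

/-- The values of the indices of the virtual legs of the vertex `v` that go out of `v`; the bond
space of the edge `e` is `ℂ ^ (D e)`. -/
abbrev OutIdx {V E : Type*} (Γ : OrientedGraph V E) (D : E → ℕ) (v : V) : Type _ :=
  (f : {f : E // Γ.o f = v}) → Fin (D f.1)

/-- The values of the indices of the virtual legs of the vertex `v` that come into `v`. -/
abbrev InIdx {V E : Type*} (Γ : OrientedGraph V E) (D : E → ℕ) (v : V) : Type _ :=
  (e : {e : E // Γ.t e = v}) → Fin (D e.1)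

/-- A collection of PEPS tensors
`A v ∈ (⨂_{o ∈ E_vᵒ} V_o) ⊗ H_v ⊗ (⨂_{t ∈ E_vᵗ} V_t^*)`, given by components in (orthonormal) bases;
the physical space of the vertex `v` is `H_v = ℂ ^ (d v)`, that of the edge `e` is
`V_e = ℂ ^ (D e)`. -/
abbrev Tensors {V E : Type*} (Γ : OrientedGraph V E) (d : V → ℕ) (D : E → ℕ) : Type _ :=
  (v : V) → Fin (d v) → OutIdx Γ D v → InIdx Γ D v → ℂ

/-- The PEPS: all virtual legs are contracted.  A vector in `⨂_v ℂ ^ (d v)` is given by its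
components in the product basis. -/
def state {V E : Type*} [Fintype V] [Fintype E] [DecidableEq E] (Γ : OrientedGraph V E)
    {d : V → ℕ} {D : E → ℕ} (A : Tensors Γ d D) : ((v : V) → Fin (d v)) → ℂ :=
  fun i => ∑ c : (e : E) → Fin (D e), ∏ v, A v (i v) (fun f => c f.1) (fun e => c e.1)

/-- The tensor product `⨂_w M w` of linear operators on `⨂_w ℂ ^ (d w)`, as a matrix in the product
basis. -/
def tensorOp {W : Type*} [Fintype W] {d : W → ℕ} (M : (w : W) → Matrix (Fin (d w)) (Fin (d w)) ℂ) :
    Matrix ((w : W) → Fin (d w)) ((w : W) → Fin (d w)) ℂ :=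
  Matrix.of fun i j => ∏ w, M w (i w) (j w)

section Blocking

variable {V E : Type*} [DecidableEq V] [DecidableEq E] {Γ : OrientedGraph V E}

/-- The uncontracted outgoing legs of the blocked tensor: the edges of the original boundary and,
with their first half, the edges of the internal boundary. -/
abbrev Subgraph.OutLeg (Λ : Subgraph Γ) : Type _ :=
  {e : E // Γ.o e ∈ Λ.verts ∧ e ∉ Λ.edges}

/-- The uncontracted incoming legs of the blocked tensor: the edges of the terminal boundary and,
with their second half, the edges of the internal boundary. -/
abbrev Subgraph.InLeg (Λ : Subgraph Γ) : Type _ :=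
  {e : E // Γ.t e ∈ Λ.verts ∧ e ∉ Λ.edges}

/-- The blocked tensor along the subgraph `Λ` (the legs of the edges of `Λ` are contracted), as the
matrix of a linear map from the uncontracted virtual legs
`⨂_{∂ₒΛ} V^* ⊗ ⨂_{∂ᵢΛ} (V^* ⊗ V) ⊗ ⨂_{∂ₜΛ} V` to the physical legs `⨂_{v ∈ Λ} H_v`. -/
def blocked {d : V → ℕ} {D : E → ℕ} (A : Tensors Γ d D) (Λ : Subgraph Γ) :
    Matrix ((v : Λ.verts) → Fin (d v.1))
      (((e : Λ.OutLeg) → Fin (D e.1)) × ((e : Λ.InLeg) → Fin (D e.1))) ℂ :=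
  Matrix.of fun i pq =>
    ∑ c : (e : Λ.edges) → Fin (D e.1), ∏ v : Λ.verts,
      A v.1 (i v)
        (fun f => if h : f.1 ∈ Λ.edges then c ⟨f.1, h⟩
          else pq.1 ⟨f.1, by rw [f.2]; exact v.2, h⟩)
        (fun e => if h : e.1 ∈ Λ.edges then c ⟨e.1, h⟩
          else pq.2 ⟨e.1, by rw [e.2]; exact v.2, h⟩)

/-- `Λ` is an injective region: the blocked tensor along `Λ` is injective as a linear map from the
virtual to the physical legs. -/
def IsInjectiveRegion [Fintype E] {d : V → ℕ} {D : E → ℕ} (A : Tensors Γ d D)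
    (Λ : Subgraph Γ) : Prop :=
  Function.Injective (blocked A Λ).mulVec

/-- The PEPS is normal: around every vertex the tensors become injective after blocking. -/
def IsNormal [Fintype E] {d : V → ℕ} {D : E → ℕ} (A : Tensors Γ d D) : Prop :=
  ∀ v : V, ∃ Λ : Subgraph Γ, v ∈ Λ.verts ∧ IsInjectiveRegion A Λ

/-- The graph is big enough for the normal PEPS: for every edge, injective regions around its
two endpoints can be chosen so that they do not overlap. -/
def IsBigEnough [Fintype E] {d : V → ℕ} {D : E → ℕ} (A : Tensors Γ d D) : Prop :=
  ∀ e : E, ∃ Λo Λt : Subgraph Γ, Γ.o e ∈ Λo.verts ∧ Γ.t e ∈ Λt.verts ∧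
    Disjoint Λo.verts Λt.verts ∧ IsInjectiveRegion A Λo ∧ IsInjectiveRegion A Λt

end Blocking

/-- A three-leg tensor `B ∈ V ⊗ H ⊗ V^*`, with components `B k a b` (`k` physical, `a` the index of
`V`, `b` that of `V^*`), is unital if `∑ k, x k • B k = 1` for some `x ∈ H^*`. -/
def IsUnital {n D : ℕ} (B : Fin n → Matrix (Fin D) (Fin D) ℂ) : Prop :=
  ∃ x : Fin n → ℂ, ∑ k, x k • B k = 1

/-- The gPEPS tensors on the barycentric subdivision which one gets from vertex tensors `A` on `Γ`
by inserting edge tensors `B e ∈ V_{eᵗ} ⊗ H_e ⊗ V_{eᵒ}^*`, where `V_{eᵒ} = V_{eᵗ} = V_e`. -/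
def insertEdges {V E : Type*} {Γ : OrientedGraph V E} {d : V → ℕ} {D : E → ℕ} {dE : E → ℕ}
    (A : Tensors Γ d D) (B : (e : E) → Fin (dE e) → Matrix (Fin (D e)) (Fin (D e)) ℂ) :
    Tensors Γ.bary (Sum.elim d dE) (Sum.elim D D)
  | Sum.inl v => fun i p q =>
      A v i (fun f => p ⟨Sum.inl f.1, congrArg Sum.inl f.2⟩)
        (fun e => q ⟨Sum.inr e.1, congrArg Sum.inl e.2⟩)
  | Sum.inr e => fun k p q => B e k (p ⟨Sum.inr e, rfl⟩) (q ⟨Sum.inl e, rfl⟩)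

section Gauge

variable {V E G : Type*} [DecidableEq V] [Group G]

/-- The tensor factors of the gauge operator
`⨂_{e ∈ E_vᵒ} R_e(g) ⊗ U_v(g) ⊗ ⨂_{e ∈ E_vᵗ} L_e(g)` centered at `v`; on all other sites it is the
identity. -/
def gaugeFactor (Γ : OrientedGraph V E) {d : V → ℕ} {dE : E → ℕ}
    (U : (v : V) → G →* GL (Fin (d v)) ℂ) (L R : (e : E) → G →* GL (Fin (dE e)) ℂ)
    (v : V) (g : G) :
    (w : V ⊕ E) → Matrix (Fin (Sum.elim d dE w)) (Fin (Sum.elim d dE w)) ℂ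
  | Sum.inl w => if w = v then (U w g : Matrix (Fin (d w)) (Fin (d w)) ℂ) else 1
  | Sum.inr e =>
      if Γ.o e = v then (R e g : Matrix (Fin (dE e)) (Fin (dE e)) ℂ)
      else if Γ.t e = v then (L e g : Matrix (Fin (dE e)) (Fin (dE e)) ℂ)
      else 1

/-- Gauge invariance of a vector in `⨂_v H_v ⊗ ⨂_e H_e`. -/
def IsGaugeInvariant [Fintype V] [Fintype E] [DecidableEq E] (Γ : OrientedGraph V E)
    {d : V → ℕ} {dE : E → ℕ}
    (U : (v : V) → G →* GL (Fin (d v)) ℂ) (L R : (e : E) → G →* GL (Fin (dE e)) ℂ)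
    (ψ : ((w : V ⊕ E) → Fin (Sum.elim d dE w)) → ℂ) : Prop :=
  ∀ (v : V) (g : G), tensorOp (gaugeFactor Γ U L R v g) *ᵥ ψ = ψ

end Gauge

/-- The vertex tensor as (the matrix of) a linear map
`⨂_{f ∈ E_vᵒ} V_f^* ⊗ ⨂_{e ∈ E_vᵗ} V_e → H_v`. -/
def vertexMap {V E : Type*} {Γ : OrientedGraph V E} {d : V → ℕ} {D : E → ℕ} (A : Tensors Γ d D)
    (v : V) : Matrix (Fin (d v)) (OutIdx Γ D v × InIdx Γ D v) ℂ :=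
  Matrix.of fun i pq => A v i pq.1 pq.2

/-- The operator `⨂_{f ∈ E_vᵒ} Vo_f⁻¹ ⊗ ⨂_{e ∈ E_vᵗ} Vt_e` on
`⨂_{f ∈ E_vᵒ} V_f^* ⊗ ⨂_{e ∈ E_vᵗ} V_e`; an operator on `V_f` acts on the dual `V_f^*` by its
transpose. -/
def vertexLegOp {V E : Type*} [Fintype E] [DecidableEq V] (Γ : OrientedGraph V E) {D : E → ℕ}
    (Vo Vt : (e : E) → GL (Fin (D e)) ℂ) (v : V) :
    Matrix (OutIdx Γ D v × InIdx Γ D v) (OutIdx Γ D v × InIdx Γ D v) ℂ :=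
  tensorOp (fun f : {f : E // Γ.o f = v} =>
      (((Vo f.1)⁻¹ : GL (Fin (D f.1)) ℂ) : Matrix (Fin (D f.1)) (Fin (D f.1)) ℂ)ᵀ) ⊗ₖ
    tensorOp (fun e : {e : E // Γ.t e = v} =>
      (Vt e.1 : Matrix (Fin (D e.1)) (Fin (D e.1)) ℂ))

end GaugePEPS

/-!
The proof compares the state with its image under a gauge transformation at one vertex `v`.

*Removing injective regions.* If a contraction of the tensors on `S ∪ Λ` vanishes for all values
of the physical indices and of the open bonds, and `Λ` is an injective region, then the
contraction over `S \ Λ` vanishes with all bonds to `Λ` open: apply the left inverse of the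
blocked tensor (`Vanishes.sdiff`). Vanishing also passes from `S` to larger sets
(`Vanishes.mono`), so regions which overlap can be removed one after the other. For a normal PEPS
everything can be removed, and since the empty contraction is not zero, no contraction of its
tensors vanishes identically (`not_vanishes_of_isNormal`).

*Tensors at a vertex.* Let `T` be any tensor with the virtual legs of `v` which gives the zero
vector when completed by the tensors at all other vertices. The graph is big enough, so every
neighbour of `v` lies in an injective region avoiding `v`. Removing these regions opens all bonds
at `v`, and what remains is `T` times a contraction which does not vanish identically; hence `T =
0` (`eq_zero_of_sum_mul_prod_eq_zero`).

*Gauge transformations at `v`.* Contracting the physical legs of the edges with functionals turns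
gauge invariance into an equality of two PEPS with matrices inserted on the edges
(`net_gauged_eq`). Away from `v` these matrices can be made trivial by unitality, and those at `v`
can be absorbed into the tensor at `v`; the previous step then gives an equality of tensors at `v`
(`tensorOp_vertexEnds_eq_of_net_eq`). If the leg of one edge `e` is kept, this equality together
with the linear independence of the slices of `A v` along `e` shows that the transformed edge
tensor differs from `B e` by a matrix `W` on the leg at `v`, the same for all physical indices
(`exists_mul_eq_of_isGaugeInvariant`). As `B e` is unital, these matrices are invertible and given
by an explicit formula, from which multiplicativity and continuity are read off
(`exists_monoidHom_of_isUnital`). If all edges are contracted, the equality of tensors at `v` is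
the intertwining relation for `A v` (`mul_vertexMap_eq`).
-/

namespace GaugePEPS

/-! ### Sums over bond configurations -/

/-- Overwriting the coordinates in `s` by fresh ones averages over them; this replaces sums over
partial bond configurations by sums over full ones. -/
theorem sum_sum_piecewise {ι : Type*} {α : ι → Type*} [Fintype ι] [DecidableEq ι]
    [∀ i, Fintype (α i)] (s : Finset ι) (g : (∀ i, α i) → ℂ) :
    ∑ x, ∑ y, g (s.piecewise y x) = Fintype.card (∀ i, α i) * ∑ x, g x := by
  have hinv : Function.Involutive (fun z : (∀ i, α i) × (∀ i, α i) =>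
      (s.piecewise z.2 z.1, s.piecewise z.1 z.2)) := by
    rintro ⟨x, y⟩
    ext i <;> by_cases h : i ∈ s <;> simp [h]
  have h := Equiv.sum_comp hinv.toPerm (fun z => g z.1)
  simp only [Function.Involutive.coe_toPerm, Fintype.sum_prod_type] at h
  rw [h]
  simp [Finset.mul_sum]

theorem exists_leftInverse_of_mulVec_injective {m n : Type*} [Fintype m] [DecidableEq m]
    [Fintype n] [DecidableEq n] (M : Matrix m n ℂ) (h : Function.Injective M.mulVec) :
    ∃ P : Matrix n m ℂ, P * M = 1 := by
  obtain ⟨g, hg⟩ := LinearMap.exists_leftInverse_of_injective M.mulVecLin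
    (LinearMap.ker_eq_bot.2 h)
  refine ⟨LinearMap.toMatrix' g, ?_⟩
  have := congrArg LinearMap.toMatrix' hg
  rwa [LinearMap.toMatrix'_comp, ← Matrix.toLin'_apply', LinearMap.toMatrix'_toLin',
    LinearMap.toMatrix'_id] at this

section Contraction

variable {V E : Type*} {Γ : OrientedGraph V E} {d : V → ℕ} {D : E → ℕ}

theorem OrientedGraph.o_ne_t (Γ : OrientedGraph V E) (e : E) : Γ.o e ≠ Γ.t e :=
  fun h => Γ.oriented e e ⟨h, h.symm⟩

/-- The tensor at `v`, for a fixed value `i` of its physical index, as a function of a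
configuration of all bond indices. -/
def amp (A : Tensors Γ d D) (v : V) (i : Fin (d v)) (c : (e : E) → Fin (D e)) : ℂ :=
  A v i (fun f => c f.1) (fun e => c e.1)

/-- A function of the bond indices is local at `v` if it only depends on the bonds at `v`. -/
def IsLocalAt (Γ : OrientedGraph V E) (v : V) (a : ((e : E) → Fin (D e)) → ℂ) : Prop :=
  ∀ c c', (∀ f, Γ.o f = v ∨ Γ.t f = v → c f = c' f) → a c = a c'

theorem isLocalAt_amp (A : Tensors Γ d D) (v : V) (i : Fin (d v)) : IsLocalAt Γ v (amp A v i) := by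
  intro c c' h
  have h1 : (fun f : {f : E // Γ.o f = v} => c f.1) = fun f : {f : E // Γ.o f = v} => c' f.1 :=
    funext fun f => h _ (Or.inl f.2)
  have h2 : (fun f : {f : E // Γ.t f = v} => c f.1) = fun f : {f : E // Γ.t f = v} => c' f.1 :=
    funext fun f => h _ (Or.inr f.2)
  simp only [amp, h1, h2]

variable [DecidableEq V] [Fintype E] [DecidableEq E]

/-- The edges with both endpoints in `S`. -/
def innerEdges (Γ : OrientedGraph V E) (S : Finset V) : Finset E :=
  Finset.univ.filter fun f => Γ.o f ∈ S ∧ Γ.t f ∈ S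

omit [DecidableEq E] in
@[simp] theorem mem_innerEdges {S : Finset V} {f : E} :
    f ∈ innerEdges Γ S ↔ Γ.o f ∈ S ∧ Γ.t f ∈ S := by
  simp [innerEdges]

/-- The contraction of local functions `b u`, `u ∈ S`, along the edges inside `S`, as a function of
the indices `c₀` of the remaining bonds.  The sum runs over the configurations of all bonds, so
it is the usual contraction up to a positive factor. -/
def contraction (Γ : OrientedGraph V E) (S : Finset V)
    (b : V → ((e : E) → Fin (D e)) → ℂ) (c₀ : (e : E) → Fin (D e)) : ℂ :=
  ∑ x, ∏ u ∈ S, b u ((innerEdges Γ S).piecewise x c₀)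

/-- All contractions over `S` of functions taken from the sets `F u`, `u ∈ S`, vanish. -/
def Vanishes (Γ : OrientedGraph V E) (F : V → Set (((e : E) → Fin (D e)) → ℂ))
    (S : Finset V) : Prop :=
  ∀ b : V → ((e : E) → Fin (D e)) → ℂ, (∀ u ∈ S, b u ∈ F u) → ∀ c₀, contraction Γ S b c₀ = 0

/-- Vanishing passes to larger vertex sets: the additional local functions depend on bonds which
are not inside `S`, so they factor out of the sum over the bonds inside `S`. -/
theorem Vanishes.mono (hD : ∀ e, 0 < D e) {F : V → Set (((e : E) → Fin (D e)) → ℂ)}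
    (hF : ∀ u, ∀ a ∈ F u, IsLocalAt Γ u a) {S S' : Finset V} (h : Vanishes Γ F S)
    (hS : S ⊆ S') : Vanishes Γ F S' := by
  intro b hb c₀
  have : ∀ e, Nonempty (Fin (D e)) := fun e => ⟨⟨0, hD e⟩⟩
  have hc : (Fintype.card ((e : E) → Fin (D e)) : ℂ) ≠ 0 := by
    exact_mod_cast Fintype.card_ne_zero
  refine (mul_eq_zero.1 ?_).resolve_left hc
  rw [contraction, ← sum_sum_piecewise (innerEdges Γ S)]
  refine Finset.sum_eq_zero fun x _ => ?_
  have hsub : innerEdges Γ S ⊆ innerEdges Γ S' := fun f hf => by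
    simp only [mem_innerEdges] at hf ⊢
    exact ⟨hS hf.1, hS hf.2⟩
  set z := (innerEdges Γ S').piecewise x c₀ with hz
  have key : ∀ y, (innerEdges Γ S').piecewise ((innerEdges Γ S).piecewise y x) c₀ =
      (innerEdges Γ S).piecewise y z := by
    intro y
    ext f
    by_cases h1 : f ∈ innerEdges Γ S
    · simp [h1, hsub h1, Finset.piecewise]
    · simp [h1, hz, Finset.piecewise]
  have hfac : ∀ y, ∏ u ∈ S', b u ((innerEdges Γ S').piecewise
      ((innerEdges Γ S).piecewise y x) c₀) =
      (∏ u ∈ S' \ S, b u z) * ∏ u ∈ S, b u ((innerEdges Γ S).piecewise y z) := by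
    intro y
    rw [key, ← Finset.prod_sdiff hS]
    congr 1
    refine Finset.prod_congr rfl fun u hu => ?_
    rw [Finset.mem_sdiff] at hu
    refine hF u _ (hb u hu.1) _ _ fun f hf => ?_
    have : f ∉ innerEdges Γ S := by
      rw [mem_innerEdges]
      rintro ⟨h1, h2⟩
      rcases hf with rfl | rfl
      exacts [hu.2 h1, hu.2 h2]
    simp [Finset.piecewise, this]
  rw [Finset.sum_congr rfl fun y _ => hfac y, ← Finset.mul_sum]
  have := h b (fun u hu => hb u (hS hu)) z
  rw [contraction] at this
  rw [this, mul_zero]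

theorem not_vanishes_empty (hD : ∀ e, 0 < D e) (F : V → Set (((e : E) → Fin (D e)) → ℂ)) :
    ¬ Vanishes Γ F ∅ := by
  intro h
  have : ∀ e, Nonempty (Fin (D e)) := fun e => ⟨⟨0, hD e⟩⟩
  have hc : (Fintype.card ((e : E) → Fin (D e)) : ℂ) ≠ 0 := by
    exact_mod_cast Fintype.card_ne_zero
  have := h (fun _ _ => 0) (by simp) (fun e => ⟨0, hD e⟩)
  simp only [contraction, Finset.prod_empty, Finset.sum_const, Finset.card_univ] at this
  exact hc (by simpa using this)

/-! ### Injective regions -/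

/-- The values of the uncontracted legs of `Λ` in a configuration of all bonds. -/
def Subgraph.legs (Λ : Subgraph Γ) (z : (e : E) → Fin (D e)) :
    ((e : Λ.OutLeg) → Fin (D e.1)) × ((e : Λ.InLeg) → Fin (D e.1)) :=
  (fun e => z e.1, fun e => z e.1)

omit [DecidableEq V] [Fintype E] [DecidableEq E] in
theorem Subgraph.legs_eq_iff (Λ : Subgraph Γ) (z z' : (e : E) → Fin (D e)) :
    Λ.legs z = Λ.legs z' ↔
      ∀ f, (Γ.o f ∈ Λ.verts ∨ Γ.t f ∈ Λ.verts) → f ∉ Λ.edges → z f = z' f := by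
  simp only [Subgraph.legs, Prod.mk.injEq, funext_iff, Subtype.forall]
  constructor
  · rintro ⟨h1, h2⟩ f (h | h) hf
    exacts [h1 f ⟨h, hf⟩, h2 f ⟨h, hf⟩]
  · exact fun h => ⟨fun f hf => h f (Or.inl hf.1) hf.2, fun f hf => h f (Or.inr hf.1) hf.2⟩

omit [DecidableEq V] in
/-- An entry of the blocked tensor, up to a positive factor, as a sum over all bonds. -/
theorem card_mul_blocked (A : Tensors Γ d D) (Λ : Subgraph Γ) (i : (v : Λ.verts) → Fin (d v.1))
    (z : (e : E) → Fin (D e)) :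
    (Fintype.card ((e : {e : E // e ∉ Λ.edges}) → Fin (D e.1)) : ℂ) * blocked A Λ i (Λ.legs z) =
      ∑ w, ∏ v : Λ.verts, amp A v.1 (i v) (Λ.edges.piecewise w z) := by
  rw [← Equiv.sum_comp (Equiv.piEquivPiSubtypeProd (· ∈ Λ.edges) (fun e => Fin (D e))).symm,
    Fintype.sum_prod_type, Finset.sum_comm]
  have : ∀ (y : (e : {e : E // e ∉ Λ.edges}) → Fin (D e.1)),
      (∑ x, ∏ v : Λ.verts, amp A v.1 (i v) (Λ.edges.piecewise
        ((Equiv.piEquivPiSubtypeProd (· ∈ Λ.edges) (fun e => Fin (D e))).symm (x, y)) z)) =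
      blocked A Λ i (Λ.legs z) := by
    intro y
    rw [blocked, Matrix.of_apply]
    refine Finset.sum_congr rfl fun x _ => Finset.prod_congr rfl fun v _ => ?_
    rw [amp]
    congr 1
    · ext f
      by_cases h : f.1 ∈ Λ.edges <;> simp [h, Equiv.piEquivPiSubtypeProd, Subgraph.legs]
    · ext f
      by_cases h : f.1 ∈ Λ.edges <;> simp [h, Equiv.piEquivPiSubtypeProd, Subgraph.legs]
  rw [Finset.sum_congr rfl fun y _ => this y]
  simp

/-- An injective region can be removed: its blocked tensor has a left inverse, which opens all
bonds at `Λ`. -/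
theorem Vanishes.sdiff (hD : ∀ e, 0 < D e) (A : Tensors Γ d D)
    {F : V → Set (((e : E) → Fin (D e)) → ℂ)} (hF : ∀ u, ∀ a ∈ F u, IsLocalAt Γ u a)
    {S : Finset V} {Λ : Subgraph Γ} (hΛ : IsInjectiveRegion A Λ)
    (hFΛ : ∀ u ∈ Λ.verts, ∀ i, amp A u i ∈ F u) (h : Vanishes Γ F (S ∪ Λ.verts)) :
    Vanishes Γ F (S \ Λ.verts) := by
  intro b hb c₀
  have hne : ∀ e, Nonempty (Fin (D e)) := fun e => ⟨⟨0, hD e⟩⟩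
  obtain ⟨P, hP⟩ := exists_leftInverse_of_mulVec_injective _ hΛ
  set I := innerEdges Γ (S ∪ Λ.verts) with hI
  set I' := innerEdges Γ (S \ Λ.verts) with hI'
  have hJI : Λ.edges ⊆ I := fun f hf => by
    rw [hI, mem_innerEdges]
    exact ⟨Finset.mem_union_right _ (Λ.o_mem f hf), Finset.mem_union_right _ (Λ.t_mem f hf)⟩
  -- The rest of the network, as a function of all bonds.
  set H : ((e : E) → Fin (D e)) → ℂ := fun z => ∏ u ∈ S \ Λ.verts, b u z with hH
  have hHcongr : ∀ z z', (∀ f, (Γ.o f ∈ S \ Λ.verts ∨ Γ.t f ∈ S \ Λ.verts) → z f = z' f) →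
      H z = H z' := by
    intro z z' hzz
    refine Finset.prod_congr rfl fun u hu => hF u _ (hb u hu) _ _ fun f hf => hzz f ?_
    rcases hf with rfl | rfl
    exacts [Or.inl hu, Or.inr hu]
  have step1 : ∀ i : (v : Λ.verts) → Fin (d v.1),
      ∑ x, blocked A Λ i (Λ.legs (I.piecewise x c₀)) * H (I.piecewise x c₀) = 0 := by
    intro i
    have hc : (Fintype.card ((e : {e : E // e ∉ Λ.edges}) → Fin (D e.1)) : ℂ) ≠ 0 := by
      exact_mod_cast Fintype.card_ne_zero
    refine (mul_eq_zero.1 ?_).resolve_left hc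
    set b' : V → ((e : E) → Fin (D e)) → ℂ :=
      fun u => if hu : u ∈ Λ.verts then amp A u (i ⟨u, hu⟩) else b u with hb'
    have hb'mem : ∀ u ∈ S ∪ Λ.verts, b' u ∈ F u := by
      intro u hu
      by_cases hΛu : u ∈ Λ.verts
      · simp only [hb', hΛu, dif_pos]
        exact hFΛ u hΛu _
      · simp only [hb', hΛu, dif_neg, not_false_eq_true]
        exact hb u (Finset.mem_sdiff.2 ⟨(Finset.mem_union.1 hu).resolve_right hΛu, hΛu⟩)
    have hG : ∀ z, ∏ u ∈ S ∪ Λ.verts, b' u z =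
        (∏ v : Λ.verts, amp A v.1 (i v) z) * H z := by
      intro z
      rw [← Finset.prod_sdiff (Finset.subset_union_right (s₁ := S) (s₂ := Λ.verts)),
        Finset.union_sdiff_right, mul_comm]
      congr 1
      · rw [← Finset.prod_coe_sort]
        refine Finset.prod_congr rfl fun v _ => ?_
        simp [hb']
      · refine Finset.prod_congr rfl fun u hu => ?_
        simp [hb', (Finset.mem_sdiff.1 hu).2]
    rw [Finset.mul_sum]
    have : ∀ x, (Fintype.card ((e : {e : E // e ∉ Λ.edges}) → Fin (D e.1)) : ℂ) *
        (blocked A Λ i (Λ.legs (I.piecewise x c₀)) * H (I.piecewise x c₀)) =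
        ∑ w, ∏ u ∈ S ∪ Λ.verts, b' u (I.piecewise (Λ.edges.piecewise w x) c₀) := by
      intro x
      rw [← mul_assoc, card_mul_blocked, Finset.sum_mul]
      refine Finset.sum_congr rfl fun w _ => ?_
      have e1 : Λ.edges.piecewise w (I.piecewise x c₀) =
          I.piecewise (Λ.edges.piecewise w x) c₀ := by
        ext f
        by_cases h1 : f ∈ Λ.edges
        · simp [h1, hJI h1, Finset.piecewise]
        · simp [h1, Finset.piecewise]
      rw [hG, ← e1]
      congr 1
      refine hHcongr _ _ fun f hf => ?_
      have : f ∉ Λ.edges := fun hf' => by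
        rcases hf with hf | hf
        exacts [(Finset.mem_sdiff.1 hf).2 (Λ.o_mem f hf'),
          (Finset.mem_sdiff.1 hf).2 (Λ.t_mem f hf')]
      simp [Finset.piecewise, this]
    rw [Finset.sum_congr rfl fun x _ => this x,
      sum_sum_piecewise Λ.edges (fun x => ∏ u ∈ S ∪ Λ.verts, b' u (I.piecewise x c₀))]
    have h0 := h b' hb'mem c₀
    rw [contraction] at h0
    rw [h0, mul_zero]
  -- Applying the left inverse fixes the legs of `Λ` to their values in `c₀`.
  have step2 : ∑ x, (if Λ.legs c₀ = Λ.legs (I.piecewise x c₀) then (1 : ℂ) else 0) *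
      H (I.piecewise x c₀) = 0 := by
    have : ∀ x, (if Λ.legs c₀ = Λ.legs (I.piecewise x c₀) then (1 : ℂ) else 0) =
        ∑ i, P (Λ.legs c₀) i * blocked A Λ i (Λ.legs (I.piecewise x c₀)) := by
      intro x
      rw [← Matrix.mul_apply, hP, Matrix.one_apply]
    simp only [this, Finset.sum_mul]
    rw [Finset.sum_comm]
    refine Finset.sum_eq_zero fun i _ => ?_
    simp only [mul_assoc]
    rw [← Finset.mul_sum, step1, mul_zero]
  have step3 : ∀ x, (if Λ.legs c₀ = Λ.legs (I.piecewise x c₀) then (1 : ℂ) else 0) *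
      H (I.piecewise x c₀) = (if Λ.legs c₀ = Λ.legs (I.piecewise x c₀) then (1 : ℂ) else 0) *
      H (I'.piecewise x c₀) := by
    intro x
    split_ifs with hx
    · rw [one_mul, one_mul]
      refine hHcongr _ _ fun f hf => ?_
      rw [Subgraph.legs_eq_iff] at hx
      by_cases hfI : f ∈ I
      · by_cases hfI' : f ∈ I'
        · simp [Finset.piecewise, hfI, hfI']
        · have h1 : Γ.o f ∈ Λ.verts ∨ Γ.t f ∈ Λ.verts := by
            simp only [hI, hI', mem_innerEdges, Finset.mem_union, Finset.mem_sdiff] at hfI hfI'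
            tauto
          have h2 : f ∉ Λ.edges := fun hf' => by
            have := Λ.o_mem f hf'
            have := Λ.t_mem f hf'
            simp only [Finset.mem_sdiff] at hf
            tauto
          rw [← hx f h1 h2]
          simp [Finset.piecewise, hfI']
      · have hfI' : f ∉ I' := by
          simp only [hI, hI', mem_innerEdges, Finset.mem_union, Finset.mem_sdiff] at hfI ⊢
          tauto
        simp [Finset.piecewise, hfI, hfI']
    · simp
  -- The indicator only involves bonds on which the rest does not depend: average over them.
  rw [Finset.sum_congr rfl fun x _ => step3 x] at step2
  set K := Finset.univ \ I' with hK
  set g : ((e : E) → Fin (D e)) → ℂ := fun x =>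
    if Λ.legs c₀ = Λ.legs (I.piecewise x c₀) then (1 : ℂ) else 0 with hg
  have hgK : ∀ x w, g (K.piecewise w x) = g w := by
    intro x w
    simp only [hg]
    refine if_congr ?_ rfl rfl
    rw [Subgraph.legs_eq_iff, Subgraph.legs_eq_iff]
    refine forall_congr' fun f => forall_congr' fun h1 => forall_congr' fun _ => ?_
    have : f ∈ K := by
      simp only [hK, hI', Finset.mem_sdiff, Finset.mem_univ, true_and, mem_innerEdges]
      tauto
    simp [Finset.piecewise, this]
  have hHK : ∀ x w, H (I'.piecewise (K.piecewise w x) c₀) = H (I'.piecewise x c₀) := by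
    intro x w
    congr 1
    ext f
    by_cases h1 : f ∈ I' <;> simp [Finset.piecewise, h1, hK]
  have step4 := sum_sum_piecewise K (fun x => g x * H (I'.piecewise x c₀))
  rw [step2, mul_zero] at step4
  simp only [hgK, hHK] at step4
  simp only [← Finset.sum_mul, ← Finset.mul_sum] at step4
  refine (mul_eq_zero.1 step4).resolve_left ?_
  have hpos : (0 : ℝ) < ∑ x, if Λ.legs c₀ = Λ.legs (I.piecewise x c₀) then (1 : ℝ) else 0 := by
    refine Finset.sum_pos' (fun x _ => by split_ifs <;> simp) ⟨c₀, Finset.mem_univ _, ?_⟩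
    rw [if_pos]
    · exact one_pos
    · congr 1
      exact (Finset.piecewise_same I c₀).symm
  have hcast : (∑ x, g x) =
      ((∑ x, if Λ.legs c₀ = Λ.legs (I.piecewise x c₀) then (1 : ℝ) else 0 : ℝ) : ℂ) := by
    rw [Complex.ofReal_sum]
    refine Finset.sum_congr rfl fun x _ => ?_
    simp only [hg]
    split_ifs <;> simp
  rw [hcast]
  exact_mod_cast hpos.ne'

/-- Vertices in injective regions which avoid `Q` can be removed. -/
theorem Vanishes.exists_disjoint (hD : ∀ e, 0 < D e) (A : Tensors Γ d D)
    {F : V → Set (((e : E) → Fin (D e)) → ℂ)} (hF : ∀ u, ∀ a ∈ F u, IsLocalAt Γ u a)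
    {S : Finset V} (h : Vanishes Γ F S) (Q P : Finset V) (hQ : Q ⊆ S)
    (hFQ : ∀ u ∉ Q, ∀ i, amp A u i ∈ F u)
    (hP : ∀ u ∈ P, ∃ Λ : Subgraph Γ, u ∈ Λ.verts ∧ Disjoint Q Λ.verts ∧ IsInjectiveRegion A Λ) :
    ∃ S', Vanishes Γ F S' ∧ Q ⊆ S' ∧ Disjoint S' P := by
  induction P using Finset.induction_on with
  | empty => exact ⟨S, h, hQ, by simp⟩
  | insert a P _ ih =>
    obtain ⟨S', h1, h2, h3⟩ := ih fun u hu => hP u (Finset.mem_insert_of_mem hu)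
    obtain ⟨Λ, ha, hQΛ, hΛ⟩ := hP a (Finset.mem_insert_self _ _)
    refine ⟨S' \ Λ.verts, (h1.mono hD hF Finset.subset_union_left).sdiff hD A hF hΛ
      (fun u hu => hFQ u fun hu' => Finset.disjoint_left.1 hQΛ hu' hu), ?_, ?_⟩
    · exact fun u hu => Finset.mem_sdiff.2 ⟨h2 hu, Finset.disjoint_left.1 hQΛ hu⟩
    · rw [Finset.disjoint_insert_right]
      exact ⟨by simp [ha], h3.mono_left Finset.sdiff_subset⟩

variable [Fintype V]

/-- Otherwise all vertices could be removed one region after the other, and the contraction over the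
empty set would vanish. -/
theorem not_vanishes_of_isNormal (hD : ∀ e, 0 < D e) (A : Tensors Γ d D) (hA : IsNormal A)
    (S : Finset V) : ¬ Vanishes Γ (fun u => Set.range (amp A u)) S := by
  intro h
  have hF : ∀ u, ∀ a ∈ Set.range (amp A u), IsLocalAt Γ u a := by
    rintro u _ ⟨i, rfl⟩
    exact isLocalAt_amp A u i
  obtain ⟨S', h1, -, h3⟩ := h.exists_disjoint hD A hF ∅ Finset.univ (Finset.empty_subset _)
    (fun u _ i => ⟨i, rfl⟩) (fun u _ => by
      obtain ⟨Λ, hu, hΛ⟩ := hA u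
      exact ⟨Λ, hu, Finset.disjoint_empty_left _, hΛ⟩)
  have : S' = ∅ := Finset.disjoint_self_iff_empty _ |>.1 (h3.mono_right (Finset.subset_univ _))
  subst this
  exact not_vanishes_empty hD _ h1

/-- A tensor at `v` is determined by the vector to which it is completed by the other vertex
tensors: the neighbours of `v` lie in injective regions avoiding `v`, and removing these opens
all bonds at `v`. -/
theorem eq_zero_of_sum_mul_prod_eq_zero (hD : ∀ e, 0 < D e) (A : Tensors Γ d D)
    (hA : IsNormal A) (hbig : IsBigEnough A) (v : V) (T : ((e : E) → Fin (D e)) → ℂ)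
    (hT : IsLocalAt Γ v T)
    (h : ∀ b : V → ((e : E) → Fin (D e)) → ℂ, (∀ u ≠ v, ∃ i, b u = amp A u i) →
      ∑ c, T c * ∏ u ∈ Finset.univ.erase v, b u c = 0) (c : (e : E) → Fin (D e)) : T c = 0 := by
  set F : V → Set (((e : E) → Fin (D e)) → ℂ) :=
    fun u => if u = v then {T} else Set.range (amp A u) with hFdef
  have hFv : F v = {T} := by simp [hFdef]
  have hFu : ∀ u, u ≠ v → F u = Set.range (amp A u) := fun u hu => by simp [hFdef, hu]
  have hF : ∀ u, ∀ a ∈ F u, IsLocalAt Γ u a := by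
    intro u a ha
    by_cases hu : u = v
    · subst hu
      rw [hFv] at ha
      rwa [Set.mem_singleton_iff.1 ha]
    · rw [hFu u hu] at ha
      obtain ⟨i, rfl⟩ := ha
      exact isLocalAt_amp A u i
  have huniv : Vanishes Γ F Finset.univ := by
    intro b hb c₀
    have e : innerEdges Γ Finset.univ = Finset.univ := by ext; simp
    rw [contraction, e, ← h b fun u hu => ?_]
    · refine Finset.sum_congr rfl fun x _ => ?_
      rw [Finset.piecewise_univ, ← Finset.mul_prod_erase _ _ (Finset.mem_univ v)]
      have := hb v (Finset.mem_univ _)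
      rw [hFv] at this
      rw [Set.mem_singleton_iff.1 this]
    · have := hb u (Finset.mem_univ _)
      rw [hFu u hu] at this
      obtain ⟨i, hi⟩ := this
      exact ⟨i, hi.symm⟩
  -- Remove all neighbours of `v`.
  obtain ⟨S, hS, hvS, hdis⟩ := huniv.exists_disjoint hD A hF {v}
    (Finset.univ.filter fun u => ∃ f, (Γ.o f = v ∧ Γ.t f = u) ∨ (Γ.t f = v ∧ Γ.o f = u))
    (Finset.subset_univ _) (fun u hu i => by
      rw [hFu u (by simpa using hu)]
      exact ⟨i, rfl⟩) (fun u hu => by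
      simp only [Finset.mem_filter, Finset.mem_univ, true_and] at hu
      obtain ⟨f, ⟨rfl, rfl⟩ | ⟨rfl, rfl⟩⟩ := hu
      · obtain ⟨Λo, Λt, h1, h2, h3, -, h5⟩ := hbig f
        exact ⟨Λt, h2, by simpa using Finset.disjoint_left.1 h3 h1, h5⟩
      · obtain ⟨Λo, Λt, h1, h2, h3, h4, -⟩ := hbig f
        exact ⟨Λo, h1, by simpa using Finset.disjoint_right.1 h3 h2, h4⟩)
  have hv : v ∈ S := hvS (Finset.mem_singleton_self v)
  have hnb : ∀ f, (Γ.o f = v → Γ.t f ∉ S) ∧ (Γ.t f = v → Γ.o f ∉ S) := by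
    intro f
    refine ⟨fun h1 h2 => ?_, fun h1 h2 => ?_⟩
    · exact Finset.disjoint_left.1 hdis h2 (by simpa using ⟨f, Or.inl ⟨h1, rfl⟩⟩)
    · exact Finset.disjoint_left.1 hdis h2 (by simpa using ⟨f, Or.inr ⟨h1, rfl⟩⟩)
  have hinner : innerEdges Γ (S.erase v) = innerEdges Γ S := by
    ext f
    have := hnb f
    simp only [mem_innerEdges, Finset.mem_erase]
    tauto
  by_contra hTc
  refine not_vanishes_of_isNormal hD A hA (S.erase v) fun b hb c₀ => ?_
  -- The contraction over `S.erase v` does not depend on the bonds at `v`; give them the values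
  -- of `c`, for which `T` is nonzero.
  set c₁ : (e : E) → Fin (D e) := fun f => if Γ.o f = v ∨ Γ.t f = v then c f else c₀ f with hc₁
  have h0 := hS (fun u => if u = v then T else b u) (fun u hu => by
    by_cases huv : u = v
    · subst huv; simp [hFv]
    · simp only [huv, if_false, hFu u huv]
      exact hb u (Finset.mem_erase.2 ⟨huv, hu⟩)) c₁
  rw [contraction] at h0
  have key : ∀ x, (∏ u ∈ S, (if u = v then T else b u) ((innerEdges Γ S).piecewise x c₁)) =
      T c * ∏ u ∈ S.erase v, b u ((innerEdges Γ (S.erase v)).piecewise x c₀) := by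
    intro x
    rw [← Finset.mul_prod_erase _ _ hv]
    congr 1
    · rw [if_pos rfl]
      refine hT _ _ fun f hf => ?_
      have : f ∉ innerEdges Γ S := by
        have := hnb f
        rw [mem_innerEdges]
        tauto
      simp [Finset.piecewise, this, hc₁, hf]
    · refine Finset.prod_congr rfl fun u hu => ?_
      rw [if_neg (Finset.mem_erase.1 hu).1, hinner]
      obtain ⟨i, hi⟩ := hb u hu
      rw [← hi]
      refine isLocalAt_amp A u i _ _ fun f hf => ?_
      have : ¬ (Γ.o f = v ∨ Γ.t f = v) := by
        have := hnb f
        rw [Finset.mem_erase] at hu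
        rcases hf with rfl | rfl <;> tauto
      simp [Finset.piecewise, hc₁, this]
  rw [Finset.sum_congr rfl fun x _ => key x, ← Finset.mul_sum] at h0
  exact (mul_eq_zero.1 h0).resolve_left hTc

end Contraction

/-! ### Legs of a vertex tensor are faithful -/

section Slices

variable {V E : Type*} {Γ : OrientedGraph V E} {d : V → ℕ} {D : E → ℕ}
  [DecidableEq V] [Fintype E] [DecidableEq E]

/-- If exactly one endpoint `v` of `e` lies in an injective region, then the slices of the tensor at
`v` along `e` are linearly independent: a relation between them would give a relation between
columns of the blocked tensor. -/
theorem eq_zero_of_sum_slices_eq_zero (hD : ∀ e, 0 < D e) (A : Tensors Γ d D) (v : V) (e : E)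
    {Λ : Subgraph Γ} (hΛ : IsInjectiveRegion A Λ) (hv : v ∈ Λ.verts)
    (he : Γ.o e = v ∧ Γ.t e ∉ Λ.verts ∨ Γ.t e = v ∧ Γ.o e ∉ Λ.verts) (y : Fin (D e) → ℂ)
    (hy : ∀ i c, ∑ b, y b * amp A v i (Function.update c e b) = 0) : y = 0 := by
  have hne : ∀ e, Nonempty (Fin (D e)) := fun e => ⟨⟨0, hD e⟩⟩
  obtain ⟨P, hP⟩ := exists_leftInverse_of_mulVec_injective _ hΛ
  have heΛ : e ∉ Λ.edges := fun h => by
    rcases he with ⟨_, h'⟩ | ⟨_, h'⟩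
    exacts [h' (Λ.t_mem e h), h' (Λ.o_mem e h)]
  let c : (e : E) → Fin (D e) := fun e => ⟨0, hD e⟩
  have step1 : ∀ i, ∑ b, y b * blocked A Λ i (Λ.legs (Function.update c e b)) = 0 := by
    intro i
    have hc : (Fintype.card ((e : {e : E // e ∉ Λ.edges}) → Fin (D e.1)) : ℂ) ≠ 0 := by
      exact_mod_cast Fintype.card_ne_zero
    refine (mul_eq_zero.1 ?_).resolve_left hc
    rw [Finset.mul_sum]
    simp only [mul_left_comm _ (y _), card_mul_blocked, Finset.mul_sum]
    rw [Finset.sum_comm]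
    refine Finset.sum_eq_zero fun w _ => ?_
    have hpw : ∀ b, Λ.edges.piecewise w (Function.update c e b) =
        Function.update (Λ.edges.piecewise w c) e b := by
      intro b
      ext f
      by_cases hf : f = e
      · subst hf
        simp [Finset.piecewise, heΛ]
      · by_cases hf' : f ∈ Λ.edges <;> simp [Finset.piecewise, hf, hf']
    have hfac : ∀ b, y b * ∏ u : Λ.verts, amp A u.1 (i u)
          (Λ.edges.piecewise w (Function.update c e b)) =
        (∏ u ∈ Finset.univ.erase (⟨v, hv⟩ : Λ.verts), amp A u.1 (i u) (Λ.edges.piecewise w c)) *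
          (y b * amp A v (i ⟨v, hv⟩) (Function.update (Λ.edges.piecewise w c) e b)) := by
      intro b
      rw [← Finset.mul_prod_erase _ _ (Finset.mem_univ (⟨v, hv⟩ : Λ.verts)), hpw, ← mul_assoc,
        mul_comm]
      congr 1
      refine Finset.prod_congr rfl fun u hu => isLocalAt_amp A u.1 (i u) _ _ fun f hf => ?_
      have huv : u.1 ≠ v := fun h => (Finset.mem_erase.1 hu).1 (Subtype.ext h)
      refine Function.update_of_ne ?_ _ _
      rintro rfl
      have := u.2
      rcases hf with hf | hf <;> rcases he with ⟨h1, h2⟩ | ⟨h1, h2⟩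
      exacts [huv (hf.symm.trans h1), h2 (hf ▸ this), h2 (hf ▸ this), huv (hf.symm.trans h1)]
    rw [Finset.sum_congr rfl fun b _ => hfac b, ← Finset.mul_sum, hy, mul_zero]
  have hinj : ∀ b b', Λ.legs (Function.update c e b) = Λ.legs (Function.update c e b') ↔
      b = b' := by
    intro b b'
    refine ⟨fun h => ?_, fun h => h ▸ rfl⟩
    rw [Subgraph.legs_eq_iff] at h
    have : Γ.o e ∈ Λ.verts ∨ Γ.t e ∈ Λ.verts := by
      rcases he with ⟨h, _⟩ | ⟨h, _⟩
      exacts [Or.inl (h ▸ hv), Or.inr (h ▸ hv)]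
    simpa using h e this heΛ
  ext b₀
  have h : ∑ b, y b * (P * blocked A Λ) (Λ.legs (Function.update c e b₀))
      (Λ.legs (Function.update c e b)) = 0 := by
    simp only [Matrix.mul_apply, Finset.mul_sum]
    rw [Finset.sum_comm]
    refine Finset.sum_eq_zero fun i _ => ?_
    simp only [mul_left_comm (y _)]
    rw [← Finset.mul_sum, step1, mul_zero]
  simpa [hP, Matrix.one_apply, hinj] using h

/-- The tensor at `v`, as a matrix from all its other indices to the leg of the edge `e`. -/
def slice (A : Tensors Γ d D) (v : V) (e : E) :
    Matrix (Fin (D e)) (Fin (d v) × ((e : E) → Fin (D e))) ℂ :=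
  Matrix.of fun b ic => amp A v ic.1 (Function.update ic.2 e b)

/-- Linear independence of the slices, using that on a big enough graph the vertex `v` lies in an
injective region which avoids the other endpoint of `e`. -/
theorem exists_rightInverse_slice (hD : ∀ e, 0 < D e) (A : Tensors Γ d D) (hbig : IsBigEnough A)
    (v : V) (e : E) (he : Γ.o e = v ∨ Γ.t e = v) :
    ∃ P : Matrix (Fin (d v) × ((e : E) → Fin (D e))) (Fin (D e)) ℂ, slice A v e * P = 1 := by
  have hinj : Function.Injective (slice A v e)ᵀ.mulVec := by
    rw [← Matrix.coe_mulVecLin, ← LinearMap.ker_eq_bot, LinearMap.ker_eq_bot']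
    intro y hy
    have hy' : ∀ i c, ∑ b, y b * amp A v i (Function.update c e b) = 0 := by
      intro i c
      have h := congrFun hy (i, c)
      rw [Matrix.mulVecLin_apply, Matrix.mulVec_transpose] at h
      exact h
    obtain ⟨Λo, Λt, h1, h2, h3, h4, h5⟩ := hbig e
    rcases he with he | he
    · exact eq_zero_of_sum_slices_eq_zero hD A v e h4 (he ▸ h1)
        (Or.inl ⟨he, Finset.disjoint_right.1 h3 h2⟩) y hy'
    · exact eq_zero_of_sum_slices_eq_zero hD A v e h5 (he ▸ h2)
        (Or.inr ⟨he, Finset.disjoint_left.1 h3 h1⟩) y hy'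
  obtain ⟨P, hP⟩ := exists_leftInverse_of_mulVec_injective _ hinj
  refine ⟨Pᵀ, ?_⟩
  have := congrArg Matrix.transpose hP
  rwa [Matrix.transpose_mul, Matrix.transpose_transpose, Matrix.transpose_one] at this

end Slices

/-! ### Representations on the bonds -/

section Representation

variable {G : Type*} [Group G] {n D : ℕ}

/-- If a representation `R` on the physical index of a unital tensor can be undone, element by
element, by a matrix on the right virtual index, then it is a representation `V` on this index:
contracting with `x` gives `V g = ∑ k, x k • ∑ l, R g k l • B l`. -/
theorem exists_monoidHom_of_isUnital [TopologicalSpace G] [IsTopologicalGroup G]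
    {B : Fin n → Matrix (Fin D) (Fin D) ℂ}
    (hB : IsUnital B) (R : G →* GL (Fin n) ℂ)
    (h : ∀ g, ∃ W : Matrix (Fin D) (Fin D) ℂ, ∀ k,
      B k = (∑ l, (R g : Matrix (Fin n) (Fin n) ℂ) k l • B l) * W) :
    ∃ ρ : G →* GL (Fin D) ℂ, (Continuous R → Continuous ρ) ∧ ∀ g k,
      ∑ l, (R g : Matrix (Fin n) (Fin n) ℂ) k l • B l =
        B k * (ρ g : Matrix (Fin D) (Fin D) ℂ) := by
  obtain ⟨x, hx⟩ := hB
  let N : G → Matrix (Fin D) (Fin D) ℂ :=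
    fun g => ∑ k, x k • ∑ l, (R g : Matrix (Fin n) (Fin n) ℂ) k l • B l
  have hN : ∀ g k, ∑ l, (R g : Matrix (Fin n) (Fin n) ℂ) k l • B l = B k * N g := by
    intro g k
    obtain ⟨W, hW⟩ := h g
    have h1 : N g * W = 1 := by
      rw [← hx, Finset.sum_mul]
      refine Finset.sum_congr rfl fun k _ => ?_
      rw [hW k, Matrix.smul_mul]
    have h2 : W * N g = 1 := mul_eq_one_comm.1 h1
    conv_rhs => rw [hW k, mul_assoc, h2, mul_one]
  let ρ₀ : G →* Matrix (Fin D) (Fin D) ℂ :=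
    { toFun := N
      map_one' := by
        simp only [N, map_one, Units.val_one, Matrix.one_apply]
        simpa using hx
      map_mul' := fun g g' => by
        have : ∀ k, ∑ m, (R (g * g') : Matrix (Fin n) (Fin n) ℂ) k m • B m =
            (∑ l, (R g : Matrix (Fin n) (Fin n) ℂ) k l • B l) * N g' := by
          intro k
          simp only [map_mul, Units.val_mul, Matrix.mul_apply, Finset.sum_smul]
          rw [Finset.sum_comm, Finset.sum_mul]
          refine Finset.sum_congr rfl fun l _ => ?_
          rw [Matrix.smul_mul, ← hN g' l, Finset.smul_sum]
          exact Finset.sum_congr rfl fun m _ => mul_smul _ _ _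
        simp only [N] at this ⊢
        simp only [this, Finset.sum_mul, Matrix.smul_mul] }
  refine ⟨ρ₀.toHomUnits, fun hR => ?_, fun g k => hN g k⟩
  have hNc : Continuous N := by
    have hRc : Continuous fun g => (R g : Matrix (Fin n) (Fin n) ℂ) := Units.continuous_val.comp hR
    refine continuous_finsetSum _ fun k _ => ?_
    have : Continuous fun g => ∑ l, (R g : Matrix (Fin n) (Fin n) ℂ) k l • B l :=
      continuous_finsetSum _ fun l _ => (hRc.matrix_elem k l).smul continuous_const
    exact this.const_smul (x k)
  refine Units.continuous_iff.2 ⟨hNc, ?_⟩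
  have : (fun g => ((ρ₀.toHomUnits g)⁻¹ : (Matrix (Fin D) (Fin D) ℂ)ˣ).val) = fun g => N g⁻¹ := by
    funext g
    rw [← map_inv]
    rfl
  rw [this]
  exact hNc.comp continuous_inv

/-- The transposed form of `exists_monoidHom_of_isUnital`, for the left virtual index. -/
theorem exists_monoidHom_of_isUnital_left [TopologicalSpace G] [IsTopologicalGroup G]
    {B : Fin n → Matrix (Fin D) (Fin D) ℂ}
    (hB : IsUnital B) (L : G →* GL (Fin n) ℂ)
    (h : ∀ g, ∃ W : Matrix (Fin D) (Fin D) ℂ, ∀ k,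
      B k = W * (∑ l, (L g : Matrix (Fin n) (Fin n) ℂ) k l • B l)) :
    ∃ ρ : G →* GL (Fin D) ℂ, (Continuous L → Continuous ρ) ∧ ∀ g k,
      ∑ l, (L g : Matrix (Fin n) (Fin n) ℂ) k l • B l =
        (((ρ g)⁻¹ : GL (Fin D) ℂ) : Matrix (Fin D) (Fin D) ℂ) * B k := by
  have hB' : IsUnital fun k => (B k)ᵀ := by
    obtain ⟨x, hx⟩ := hB
    refine ⟨x, ?_⟩
    rw [← Matrix.transpose_one, ← hx, Matrix.transpose_sum]
    simp
  obtain ⟨σ, hσ, hσB⟩ := exists_monoidHom_of_isUnital hB' L fun g => by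
    obtain ⟨W, hW⟩ := h g
    refine ⟨Wᵀ, fun k => ?_⟩
    conv_lhs => rw [hW k]
    rw [Matrix.transpose_mul, Matrix.transpose_sum]
    simp
  let τ : G →* Matrix (Fin D) (Fin D) ℂ :=
    { toFun := fun g => (σ g⁻¹ : Matrix (Fin D) (Fin D) ℂ)ᵀ
      map_one' := by simp
      map_mul' := fun g g' => by
        rw [_root_.mul_inv_rev, map_mul, Units.val_mul, Matrix.transpose_mul] }
  have hinv : ∀ g, (((τ.toHomUnits g)⁻¹ : GL (Fin D) ℂ) : Matrix (Fin D) (Fin D) ℂ) =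
      (σ g : Matrix (Fin D) (Fin D) ℂ)ᵀ := by
    intro g
    rw [← map_inv]
    change (σ g⁻¹⁻¹ : Matrix (Fin D) (Fin D) ℂ)ᵀ = _
    rw [inv_inv]
  refine ⟨τ.toHomUnits, fun hL => ?_, fun g k => ?_⟩
  · have hc : Continuous fun g => (σ g : Matrix (Fin D) (Fin D) ℂ)ᵀ :=
      (Units.continuous_val.comp (hσ hL)).matrix_transpose
    refine Units.continuous_iff.2 ⟨hc.comp continuous_inv, ?_⟩
    simp only [hinv]
    exact hc
  · rw [hinv, ← Matrix.transpose_inj, Matrix.transpose_mul, Matrix.transpose_transpose, ← hσB g k,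
      Matrix.transpose_sum]
    simp

end Representation

/-! ### Product operators and their action on states -/

section TensorOp

variable {W : Type*} [Fintype W] {d : W → ℕ}

theorem tensorOp_mul [DecidableEq W] (M N : (w : W) → Matrix (Fin (d w)) (Fin (d w)) ℂ) :
    tensorOp M * tensorOp N = tensorOp fun w => M w * N w := by
  ext i j
  simp only [tensorOp, Matrix.mul_apply, Matrix.of_apply, ← Finset.prod_mul_distrib]
  exact (Fintype.prod_sum fun w k => M w (i w) k * N w k (j w)).symm

theorem tensorOp_one [DecidableEq W] :
    tensorOp (fun w => (1 : Matrix (Fin (d w)) (Fin (d w)) ℂ)) = 1 := by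
  ext i j
  simp only [tensorOp, Matrix.of_apply]
  by_cases h : i = j
  · subst h
    simp only [Matrix.one_apply_eq, Finset.prod_const_one]
  · obtain ⟨w, hw⟩ := Function.ne_iff.1 h
    rw [Matrix.one_apply_ne h]
    exact Finset.prod_eq_zero (Finset.mem_univ w) (Matrix.one_apply_ne hw)

/-- The factor at `w` of a product operator can be applied last. -/
theorem tensorOp_update_mulVec [DecidableEq W] (M : (w : W) → Matrix (Fin (d w)) (Fin (d w)) ℂ)
    (w : W) (X : Matrix (Fin (d w)) (Fin (d w)) ℂ) (a : ((w : W) → Fin (d w)) → ℂ)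
    (c : (w : W) → Fin (d w)) :
    (tensorOp (Function.update M w X) *ᵥ a) c =
      ∑ b, X (c w) b * (tensorOp (Function.update M w 1) *ᵥ a) (Function.update c w b) := by
  have h : tensorOp (Function.update M w X) =
      tensorOp (Function.update (fun w => (1 : Matrix (Fin (d w)) (Fin (d w)) ℂ)) w X) *
        tensorOp (Function.update M w 1) := by
    rw [tensorOp_mul]
    congr 1
    ext1 u
    by_cases hu : u = w
    · subst hu; simp
    · simp [hu]
  rw [h, ← Matrix.mulVec_mulVec]
  set a' := tensorOp (Function.update M w 1) *ᵥ a
  simp only [Matrix.mulVec, dotProduct]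
  refine (Fintype.sum_of_injective (fun b => Function.update c w b)
    (Function.update_injective c w) _ _ (fun y hy => ?_) fun b => ?_).symm
  · have : ∃ u, u ≠ w ∧ c u ≠ y u := by
      by_contra! hcon
      refine hy ⟨y w, ?_⟩
      ext u
      by_cases hu : u = w
      · subst hu; simp
      · simp [hu, hcon u hu]
    obtain ⟨u, hu, hcu⟩ := this
    rw [tensorOp, Matrix.of_apply, Finset.prod_eq_zero (Finset.mem_univ u), zero_mul]
    rw [Function.update_of_ne hu, Matrix.one_apply_ne hcu]
  · congr 1
    rw [tensorOp, Matrix.of_apply, ← Finset.mul_prod_erase _ _ (Finset.mem_univ w),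
      Finset.prod_eq_one, mul_one, Function.update_self, Function.update_self]
    intro u hu
    have hu := (Finset.mem_erase.1 hu).1
    rw [Function.update_of_ne hu, Function.update_of_ne hu, Matrix.one_apply_eq]

end TensorOp

theorem tensorOp_mulVec_state {V E : Type*} [Fintype V] [DecidableEq V] [Fintype E] [DecidableEq E]
    (Γ : OrientedGraph V E) {d : V → ℕ} {D : E → ℕ} (A : Tensors Γ d D)
    (M : (v : V) → Matrix (Fin (d v)) (Fin (d v)) ℂ) :
    tensorOp M *ᵥ state Γ A = state Γ fun v i p q => ∑ j, M v i j * A v j p q := by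
  ext i
  simp only [Matrix.mulVec, dotProduct, state, tensorOp, Matrix.of_apply, Finset.mul_sum]
  rw [Finset.sum_comm]
  refine Finset.sum_congr rfl fun c _ => ?_
  rw [Fintype.prod_sum]
  simp only [Finset.prod_mul_distrib]

section Net

variable {V E : Type*} [Fintype V] [DecidableEq V] [Fintype E] [DecidableEq E]
  {Γ : OrientedGraph V E} {d : V → ℕ} {D : E → ℕ} {dE : E → ℕ}

/-- The PEPS with a matrix `M e` inserted on every edge `e`; `p` and `q` are the values of the
indices at the origins and at the termini of the edges. -/
def net (A : Tensors Γ d D) (M : (e : E) → Matrix (Fin (D e)) (Fin (D e)) ℂ)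
    (i : (v : V) → Fin (d v)) : ℂ :=
  ∑ p : (e : E) → Fin (D e), ∑ q : (e : E) → Fin (D e),
    (∏ v, A v (i v) (fun f => p f.1) (fun e => q e.1)) * ∏ e, M e (q e) (p e)

omit [DecidableEq V] in
/-- The gPEPS as a PEPS on `Γ` with the edge tensors inserted on the edges. -/
theorem state_insertEdges (A : Tensors Γ d D)
    (B : (e : E) → Fin (dE e) → Matrix (Fin (D e)) (Fin (D e)) ℂ)
    (I : (w : V ⊕ E) → Fin (Sum.elim d dE w)) :
    state Γ.bary (insertEdges A B) I =
      net A (fun e => B e (I (Sum.inr e))) fun v => I (Sum.inl v) := by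
  change _ = ∑ p : (e : E) → Fin (D e), ∑ q : (e : E) → Fin (D e),
    (∏ v, A v (I (Sum.inl v)) (fun f => p f.1) (fun e => q e.1)) *
      ∏ e, B e (I (Sum.inr e)) (q e) (p e)
  rw [state, ← Equiv.sum_comp (Equiv.sumPiEquivProdPi _).symm, Fintype.sum_prod_type]
  refine Finset.sum_congr rfl fun p _ => Finset.sum_congr rfl fun q _ => ?_
  rw [Fintype.prod_sum_type]
  rfl

omit [DecidableEq V] in
/-- Contracting the physical legs of the edges of a gPEPS with functionals `φ`. -/
theorem sum_prod_mul_state_insertEdges (A : Tensors Γ d D)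
    (B : (e : E) → Fin (dE e) → Matrix (Fin (D e)) (Fin (D e)) ℂ) (φ : (e : E) → Fin (dE e) → ℂ)
    (i : (v : V) → Fin (d v)) :
    ∑ k : (e : E) → Fin (dE e), (∏ e, φ e (k e)) *
        state Γ.bary (insertEdges A B) ((Equiv.sumPiEquivProdPi _).symm (i, k)) =
      net A (fun e => ∑ l, φ e l • B e l) i := by
  simp only [state_insertEdges, net, Finset.mul_sum]
  rw [Finset.sum_comm]
  refine Finset.sum_congr rfl fun p _ => ?_
  rw [Finset.sum_comm]
  refine Finset.sum_congr rfl fun q _ => ?_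
  have h : ∀ e, (∑ l, φ e l • B e l) (q e) (p e) = ∑ l, φ e l * B e l (q e) (p e) := by
    intro e
    simp [Matrix.sum_apply]
  simp only [h]
  rw [Fintype.prod_sum, Finset.mul_sum]
  refine Finset.sum_congr rfl fun k _ => ?_
  rw [Finset.prod_mul_distrib]
  simp only [Equiv.sumPiEquivProdPi_symm_apply]
  ring

end Net

section GaugeAction

variable {V E G : Type*} [Fintype V] [DecidableEq V] [Fintype E] [DecidableEq E] [Group G]
  {Γ : OrientedGraph V E} {d : V → ℕ} {D : E → ℕ} {dE : E → ℕ}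

/-- The vertex tensors after a gauge transformation at `v`. -/
def gaugedTensors (U : (v : V) → G →* GL (Fin (d v)) ℂ) (A : Tensors Γ d D) (v : V) (g : G) :
    Tensors Γ d D :=
  fun w i p q => ∑ j, (if w = v then (U w g : Matrix (Fin (d w)) (Fin (d w)) ℂ) else 1) i j *
    A w j p q

/-- The edge tensors after a gauge transformation at `v`. -/
def gaugedEdges (Γ : OrientedGraph V E) (L R : (e : E) → G →* GL (Fin (dE e)) ℂ)
    (B : (e : E) → Fin (dE e) → Matrix (Fin (D e)) (Fin (D e)) ℂ) (v : V) (g : G) (e : E)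
    (k : Fin (dE e)) : Matrix (Fin (D e)) (Fin (D e)) ℂ :=
  ∑ l, (if Γ.o e = v then (R e g : Matrix (Fin (dE e)) (Fin (dE e)) ℂ)
    else if Γ.t e = v then (L e g : Matrix (Fin (dE e)) (Fin (dE e)) ℂ) else 1) k l • B e l

omit [Fintype V] [Fintype E] [DecidableEq E] in
theorem gaugedEdges_apply (Γ : OrientedGraph V E) (L R : (e : E) → G →* GL (Fin (dE e)) ℂ)
    (B : (e : E) → Fin (dE e) → Matrix (Fin (D e)) (Fin (D e)) ℂ) (v : V) (g : G) (e : E)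
    (k : Fin (dE e)) (a b : Fin (D e)) :
    gaugedEdges Γ L R B v g e k a b =
      ∑ l, (if Γ.o e = v then (R e g : Matrix (Fin (dE e)) (Fin (dE e)) ℂ)
        else if Γ.t e = v then (L e g : Matrix (Fin (dE e)) (Fin (dE e)) ℂ) else 1) k l *
          B e l a b := by
  simp only [gaugedEdges, Matrix.sum_apply, Matrix.smul_apply, smul_eq_mul]

/-- Gauge invariance at `v`, with the physical legs of the edges contracted with functionals `φ`. -/
theorem net_gauged_eq {U : (v : V) → G →* GL (Fin (d v)) ℂ}
    {L R : (e : E) → G →* GL (Fin (dE e)) ℂ} {A : Tensors Γ d D}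
    {B : (e : E) → Fin (dE e) → Matrix (Fin (D e)) (Fin (D e)) ℂ}
    (h : IsGaugeInvariant Γ U L R (state Γ.bary (insertEdges A B))) (v : V) (g : G)
    (φ : (e : E) → Fin (dE e) → ℂ) (i : (v : V) → Fin (d v)) :
    net (gaugedTensors U A v g) (fun e => ∑ l, φ e l • gaugedEdges Γ L R B v g e l) i =
      net A (fun e => ∑ l, φ e l • B e l) i := by
  have hins : (fun w i p q => ∑ j, gaugeFactor Γ U L R v g w i j * insertEdges A B w j p q) =
      insertEdges (gaugedTensors U A v g) (gaugedEdges Γ L R B v g) := by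
    funext w i p q
    rcases w with w | e
    · rfl
    · exact (gaugedEdges_apply Γ L R B v g e i _ _).symm
  have hst : state Γ.bary (insertEdges (gaugedTensors U A v g) (gaugedEdges Γ L R B v g)) =
      state Γ.bary (insertEdges A B) := by
    rw [← hins, ← tensorOp_mulVec_state, h v g]
  rw [← sum_prod_mul_state_insertEdges, ← sum_prod_mul_state_insertEdges, hst]

end GaugeAction

/-! ### Moving edge matrices to a vertex -/

section VertexEnds

variable {V E : Type*} [Fintype V] [DecidableEq V] [Fintype E] [DecidableEq E]
  {Γ : OrientedGraph V E} {d : V → ℕ} {D : E → ℕ}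

/-- A matrix `X` on the edge `e`, read as an operator on the leg of `e` at the vertex `v`:
transposed if `e` comes into `v`, and replaced by the identity if `e` does not meet `v`. -/
def legMatrix (Γ : OrientedGraph V E) (v : V) (e : E) (X : Matrix (Fin (D e)) (Fin (D e)) ℂ) :
    Matrix (Fin (D e)) (Fin (D e)) ℂ :=
  if Γ.o e = v then X else if Γ.t e = v then Xᵀ else 1

/-- The operators on the legs at `v` given by matrices `M e` on the edges. -/
def vertexEnds (Γ : OrientedGraph V E) (v : V) (M : (e : E) → Matrix (Fin (D e)) (Fin (D e)) ℂ)
    (e : E) : Matrix (Fin (D e)) (Fin (D e)) ℂ :=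
  legMatrix Γ v e (M e)

/-- If the inserted matrices are trivial away from `v`, they can be absorbed into the tensor
at `v`. -/
theorem net_eq_sum_vertexEnds (A : Tensors Γ d D)
    (M : (e : E) → Matrix (Fin (D e)) (Fin (D e)) ℂ) (v : V)
    (hM : ∀ e, Γ.o e ≠ v → Γ.t e ≠ v → M e = 1) (i : (v : V) → Fin (d v)) :
    net A M i = ∑ c, (tensorOp (vertexEnds Γ v M) *ᵥ amp A v (i v)) c *
      ∏ u ∈ Finset.univ.erase v, amp A u (i u) c := by
  -- The index of an edge at `v` belongs to its origin or to its terminus: exchange the two at the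
  -- edges going out of `v`, so that `q` carries the legs of `v` and `p` the legs of its neighbours.
  set s := Finset.univ.filter fun e => Γ.o e = v with hs
  have hinv : Function.Involutive
      (fun z : ((e : E) → Fin (D e)) × ((e : E) → Fin (D e)) =>
        (s.piecewise z.2 z.1, s.piecewise z.1 z.2)) := by
    rintro ⟨x, y⟩
    ext i <;> by_cases h : i ∈ s <;> simp [h, Finset.piecewise]
  simp only [Matrix.mulVec, dotProduct, Finset.sum_mul]
  rw [net, ← Fintype.sum_prod_type', ← Fintype.sum_prod_type']
  conv_rhs => rw [← Equiv.sum_comp hinv.toPerm]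
  refine Finset.sum_congr rfl fun z _ => ?_
  obtain ⟨p, q⟩ := z
  simp only [Function.Involutive.coe_toPerm]
  have hprod : tensorOp (vertexEnds Γ v M) (s.piecewise q p) (s.piecewise p q) =
      ∏ e, M e (q e) (p e) := by
    rw [tensorOp, Matrix.of_apply]
    refine Finset.prod_congr rfl fun e _ => ?_
    by_cases ho : Γ.o e = v
    · simp [vertexEnds, legMatrix, hs, ho]
    · by_cases ht : Γ.t e = v
      · simp [vertexEnds, legMatrix, hs, ho, ht]
      · simp only [vertexEnds, legMatrix, ho, ht, if_false, hM e ho ht]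
        have : e ∉ s := by simp [hs, ho]
        simp [Finset.piecewise, this, Matrix.one_apply, eq_comm]
  rw [hprod]
  by_cases h0 : ∏ e, M e (q e) (p e) = 0
  · simp [h0]
  have hpq : ∀ e, Γ.o e ≠ v → Γ.t e ≠ v → q e = p e := by
    intro e ho ht
    by_contra hne
    refine h0 (Finset.prod_eq_zero (Finset.mem_univ e) ?_)
    rw [hM e ho ht, Matrix.one_apply_ne hne]
  rw [← Finset.mul_prod_erase _ _ (Finset.mem_univ v), mul_comm, mul_assoc]
  congr 1
  congr 1
  · rw [amp]
    congr 1
    · ext f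
      simp [hs, f.2]
    · ext f
      have : Γ.o f.1 ≠ v := fun h => Γ.o_ne_t f.1 (h.trans f.2.symm)
      simp [hs, this]
  · refine Finset.prod_congr rfl fun u hu => ?_
    have hu : u ≠ v := (Finset.mem_erase.1 hu).1
    rw [amp]
    congr 1
    · ext f
      have : Γ.o f.1 ≠ v := fun h => hu (f.2.symm.trans h)
      simp [hs, this]
    · ext f
      by_cases ho : Γ.o f.1 = v
      · simp [hs, ho]
      · have ht : Γ.t f.1 ≠ v := fun h => hu (f.2.symm.trans h)
        simp [hs, ho, hpq f.1 ho ht]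

omit [Fintype V] in
theorem isLocalAt_tensorOp_mulVec (v : V) (N : (e : E) → Matrix (Fin (D e)) (Fin (D e)) ℂ)
    (hN : ∀ e, Γ.o e ≠ v → Γ.t e ≠ v → N e = 1) (a : ((e : E) → Fin (D e)) → ℂ)
    (ha : IsLocalAt Γ v a) : IsLocalAt Γ v (tensorOp N *ᵥ a) := by
  intro c c' h
  simp only [Matrix.mulVec, dotProduct, tensorOp, Matrix.of_apply]
  -- Away from `v`, exchange the values of `c` and `c'`.
  rw [← Equiv.sum_comp (Equiv.piCongrRight fun e =>
    if Γ.o e = v ∨ Γ.t e = v then Equiv.refl _ else Equiv.swap (c e) (c' e))]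
  refine Finset.sum_congr rfl fun y _ => ?_
  congr 1
  · refine Finset.prod_congr rfl fun e _ => ?_
    by_cases he : Γ.o e = v ∨ Γ.t e = v
    · simp [he, h e he]
    · rw [not_or] at he
      rw [hN e he.1 he.2]
      simp only [Equiv.piCongrRight_apply, Pi.map_apply, he, or_self, if_false, Matrix.one_apply]
      refine if_congr ?_ rfl rfl
      rw [eq_comm, Equiv.swap_apply_eq_iff, Equiv.swap_apply_left, eq_comm]
  · refine ha _ _ fun f hf => ?_
    simp [hf]

omit [Fintype V] in
/-- An operator acting on the legs at `v`, written with the indices of these legs only. -/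
theorem tensorOp_mulVec_amp (A : Tensors Γ d D) (v : V)
    (N : (e : E) → Matrix (Fin (D e)) (Fin (D e)) ℂ)
    (hN : ∀ e, Γ.o e ≠ v → Γ.t e ≠ v → N e = 1) (i : Fin (d v)) (c : (e : E) → Fin (D e)) :
    (tensorOp N *ᵥ amp A v i) c = ∑ pq : OutIdx Γ D v × InIdx Γ D v,
      ((∏ f : {f : E // Γ.o f = v}, N f.1 (c f.1) (pq.1 f)) *
        ∏ f : {f : E // Γ.t f = v}, N f.1 (c f.1) (pq.2 f)) * A v i pq.1 pq.2 := by
  -- Only the configurations which agree with `c` away from `v` contribute.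
  let glue : OutIdx Γ D v × InIdx Γ D v → (e : E) → Fin (D e) := fun pq e =>
    if h : Γ.o e = v then pq.1 ⟨e, h⟩ else if h : Γ.t e = v then pq.2 ⟨e, h⟩ else c e
  have hout : ∀ pq (f : {f : E // Γ.o f = v}), glue pq f.1 = pq.1 f := by
    intro pq f
    simp [glue, f.2]
  have hin : ∀ pq (f : {f : E // Γ.t f = v}), glue pq f.1 = pq.2 f := by
    intro pq f
    have : Γ.o f.1 ≠ v := fun h => Γ.o_ne_t f.1 (h.trans f.2.symm)
    simp [glue, f.2, this]
  have hoff : ∀ pq e, Γ.o e ≠ v → Γ.t e ≠ v → glue pq e = c e := by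
    intro pq e h1 h2
    simp [glue, h1, h2]
  simp only [Matrix.mulVec, dotProduct]
  refine (Fintype.sum_of_injective glue ?_ _ _ (fun y hy => ?_) fun pq => ?_).symm
  · intro pq pq' h
    refine Prod.ext (funext fun f => ?_) (funext fun f => ?_)
    · rw [← hout pq, ← hout pq', h]
    · rw [← hin pq, ← hin pq', h]
  · have : ∃ e, Γ.o e ≠ v ∧ Γ.t e ≠ v ∧ c e ≠ y e := by
      by_contra! hcon
      refine hy ⟨(fun f => y f.1, fun f => y f.1), ?_⟩
      ext e
      by_cases h1 : Γ.o e = v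
      · simp [glue, h1]
      · by_cases h2 : Γ.t e = v
        · simp [glue, h1, h2]
        · simp [glue, h1, h2, hcon e h1 h2]
    obtain ⟨e, h1, h2, h3⟩ := this
    rw [tensorOp, Matrix.of_apply, Finset.prod_eq_zero (Finset.mem_univ e), zero_mul]
    rw [hN e h1 h2, Matrix.one_apply_ne h3]
  · congr 1
    · rw [tensorOp, Matrix.of_apply]
      have e1 : (∏ f : {f : E // Γ.o f = v}, N f.1 (c f.1) (pq.1 f)) =
          ∏ f, if Γ.o f = v then N f (c f) (glue pq f) else 1 := by
        rw [← Finset.prod_filter, Finset.prod_subtype (p := fun f => Γ.o f = v)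
          (F := inferInstance) _ (by simp)]
        simp only [hout]
      have e2 : (∏ f : {f : E // Γ.t f = v}, N f.1 (c f.1) (pq.2 f)) =
          ∏ f, if Γ.t f = v then N f (c f) (glue pq f) else 1 := by
        rw [← Finset.prod_filter, Finset.prod_subtype (p := fun f => Γ.t f = v)
          (F := inferInstance) _ (by simp)]
        simp only [hin]
      rw [e1, e2, ← Finset.prod_mul_distrib]
      refine Finset.prod_congr rfl fun f _ => ?_
      by_cases h1 : Γ.o f = v
      · have h2 : Γ.t f ≠ v := fun h => Γ.o_ne_t f (h1.trans h.symm)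
        simp [h1, h2]
      · by_cases h2 : Γ.t f = v
        · simp [h1, h2]
        · simp [h1, h2, hN f h1 h2, hoff pq f h1 h2]
    · simp only [amp, hout, hin]

end VertexEnds

/-! ### Gauge transformations at a vertex -/

section Symmetry

variable {V E G : Type*} [Fintype V] [DecidableEq V] [Fintype E] [DecidableEq E] [Group G]
  {Γ : OrientedGraph V E} {d : V → ℕ} {D : E → ℕ} {dE : E → ℕ}

/-- Equality of two networks which differ in the tensor at `v` and in the matrices on the edges
at `v` is an equality of tensors at `v`. -/
theorem tensorOp_vertexEnds_eq_of_net_eq (hD : ∀ e, 0 < D e) {A A' : Tensors Γ d D}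
    (hA : IsNormal A) (hbig : IsBigEnough A) (v : V) (hA' : ∀ u ≠ v, A' u = A u)
    {M M' : (e : E) → Matrix (Fin (D e)) (Fin (D e)) ℂ}
    (hM : ∀ e, Γ.o e ≠ v → Γ.t e ≠ v → M e = 1) (hM' : ∀ e, Γ.o e ≠ v → Γ.t e ≠ v → M' e = 1)
    (h : ∀ i, net A' M' i = net A M i) (j : Fin (d v)) :
    tensorOp (vertexEnds Γ v M') *ᵥ amp A' v j = tensorOp (vertexEnds Γ v M) *ᵥ amp A v j := by
  have hends : ∀ e, Γ.o e ≠ v → Γ.t e ≠ v → vertexEnds Γ v M e = 1 := fun e h1 h2 => by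
    simp [vertexEnds, legMatrix, h1, h2]
  have hends' : ∀ e, Γ.o e ≠ v → Γ.t e ≠ v → vertexEnds Γ v M' e = 1 := fun e h1 h2 => by
    simp [vertexEnds, legMatrix, h1, h2]
  rw [← sub_eq_zero]
  funext c
  refine eq_zero_of_sum_mul_prod_eq_zero hD A hA hbig v _ ?_ ?_ c
  · intro c c' hc
    simp only [Pi.sub_apply]
    rw [isLocalAt_tensorOp_mulVec v _ hends' _ (isLocalAt_amp A' v j) c c' hc,
      isLocalAt_tensorOp_mulVec v _ hends _ (isLocalAt_amp A v j) c c' hc]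
  · intro b hb
    have hex : ∀ u, ∃ i : Fin (d u), u ≠ v → b u = amp A u i := by
      intro u
      by_cases hu : u = v
      · subst hu
        exact ⟨j, fun h => absurd rfl h⟩
      · obtain ⟨i, hi⟩ := hb u hu
        exact ⟨i, fun _ => hi⟩
    choose i₀ hi₀ using hex
    have hi := h (Function.update i₀ v j)
    rw [net_eq_sum_vertexEnds A' M' v hM', net_eq_sum_vertexEnds A M v hM, ← sub_eq_zero,
      ← Finset.sum_sub_distrib] at hi
    rw [← hi]
    refine Finset.sum_congr rfl fun c _ => ?_
    have e1 : ∏ u ∈ Finset.univ.erase v, amp A' u (Function.update i₀ v j u) c =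
        ∏ u ∈ Finset.univ.erase v, b u c := by
      refine Finset.prod_congr rfl fun u hu => ?_
      have hu := (Finset.mem_erase.1 hu).1
      rw [Function.update_of_ne hu, hi₀ u hu, amp, amp, hA' u hu]
    have e2 : ∏ u ∈ Finset.univ.erase v, amp A u (Function.update i₀ v j u) c =
        ∏ u ∈ Finset.univ.erase v, b u c := by
      refine Finset.prod_congr rfl fun u hu => ?_
      have hu := (Finset.mem_erase.1 hu).1
      rw [Function.update_of_ne hu, hi₀ u hu]
    rw [e1, e2, Function.update_self, Pi.sub_apply, sub_mul]

omit [Fintype V] [Fintype E] [DecidableEq E] in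
theorem gaugedTensors_of_ne (U : (v : V) → G →* GL (Fin (d v)) ℂ) (A : Tensors Γ d D) {v u : V}
    (hu : u ≠ v) (g : G) : gaugedTensors U A v g u = A u := by
  funext i p q
  simp [gaugedTensors, hu, Matrix.one_apply]

omit [Fintype V] [Fintype E] [DecidableEq E] in
theorem gaugedEdges_of_ne (L R : (e : E) → G →* GL (Fin (dE e)) ℂ)
    (B : (e : E) → Fin (dE e) → Matrix (Fin (D e)) (Fin (D e)) ℂ) {v : V} {e : E}
    (ho : Γ.o e ≠ v) (ht : Γ.t e ≠ v) (g : G) : gaugedEdges Γ L R B v g e = B e := by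
  funext k
  simp [gaugedEdges, ho, ht, Matrix.one_apply]

/-- At an edge which meets `v`, a gauge transformation at `v` of the edge tensor can be undone by
a matrix acting on the leg of the edge at `v`. -/
theorem exists_mul_eq_of_isGaugeInvariant (hD : ∀ e, 0 < D e) {A : Tensors Γ d D}
    (hA : IsNormal A) (hbig : IsBigEnough A)
    {B : (e : E) → Fin (dE e) → Matrix (Fin (D e)) (Fin (D e)) ℂ} (hB : ∀ e, IsUnital (B e))
    {U : (v : V) → G →* GL (Fin (d v)) ℂ} {L R : (e : E) → G →* GL (Fin (dE e)) ℂ}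
    (h : IsGaugeInvariant Γ U L R (state Γ.bary (insertEdges A B))) (v : V) (e : E)
    (he : Γ.o e = v ∨ Γ.t e = v) (g : G) :
    ∃ W : Matrix (Fin (D e)) (Fin (D e)) ℂ, ∀ k,
      legMatrix Γ v e (B e k) = legMatrix Γ v e (gaugedEdges Γ L R B v g e k) * W := by
  choose x hx using hB
  obtain ⟨P, hP⟩ := exists_rightInverse_slice hD A hbig v e he
  have hends : ∀ (M : (e : E) → Matrix (Fin (D e)) (Fin (D e)) ℂ) (X : Matrix _ _ ℂ),
      vertexEnds Γ v (Function.update M e X) = Function.update (vertexEnds Γ v M) e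
        (legMatrix Γ v e X) := by
    intro M X
    funext f
    by_cases hf : f = e
    · subst hf
      simp [vertexEnds, legMatrix, legMatrix]
    · simp [vertexEnds, legMatrix, hf]
  -- All edges other than `e` are contracted with functionals which turn `B` into the identity;
  -- the tensor `Q` obtained at `v` from the transformed side does not depend on the index at `e`.
  let M₀ : (e : E) → Matrix (Fin (D e)) (Fin (D e)) ℂ :=
    fun f => ∑ l, x f l • gaugedEdges Γ L R B v g f l
  let Q : Matrix (Fin (D e)) (Fin (d v) × ((e : E) → Fin (D e))) ℂ := Matrix.of fun b jc =>
    (tensorOp (Function.update (vertexEnds Γ v M₀) e 1) *ᵥ amp (gaugedTensors U A v g) v jc.1)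
      (Function.update jc.2 e b)
  refine ⟨Q * P, fun k => ?_⟩
  have hφ : ∀ (C : (e : E) → Fin (dE e) → Matrix (Fin (D e)) (Fin (D e)) ℂ),
      (fun f => ∑ l, Function.update x e (Pi.single k 1) f l • C f l) =
        Function.update (fun f => ∑ l, x f l • C f l) e (C e k) := by
    intro C
    funext f
    by_cases hf : f = e
    · subst hf
      simp [Pi.single_apply]
    · simp [hf]
  have hnet : ∀ i, net (gaugedTensors U A v g)
      (Function.update M₀ e (gaugedEdges Γ L R B v g e k)) i =
      net A (Function.update (fun _ => 1) e (B e k)) i := by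
    intro i
    have := net_gauged_eq h v g (Function.update x e (Pi.single k 1)) i
    rw [hφ, hφ] at this
    rw [this]
    congr 2
    funext f
    exact hx f
  have hne : ∀ f, Γ.o f ≠ v → Γ.t f ≠ v → f ≠ e := by
    rintro f h1 h2 rfl
    exact he.elim h1 h2
  have key := tensorOp_vertexEnds_eq_of_net_eq hD hA hbig v
    (fun u hu => gaugedTensors_of_ne U A hu g)
    (fun f h1 h2 => by rw [Function.update_of_ne (hne f h1 h2)])
    (fun f h1 h2 => by
      rw [Function.update_of_ne (hne f h1 h2)]
      simp only [M₀, gaugedEdges_of_ne L R B h1 h2, hx]) hnet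
  have hones : vertexEnds Γ v (fun f => (1 : Matrix (Fin (D f)) (Fin (D f)) ℂ)) = fun _ => 1 := by
    funext f
    simp [vertexEnds, legMatrix, legMatrix]
  simp only [hends, hones] at key
  set X := legMatrix Γ v e (B e k)
  set X' := legMatrix Γ v e (gaugedEdges Γ L R B v g e k)
  have hmat : X' * Q = X * slice A v e := by
    ext a ⟨j, c⟩
    have := congrFun (key j) (Function.update c e a)
    rw [tensorOp_update_mulVec, tensorOp_update_mulVec] at this
    have h1 : Function.update (fun f => (1 : Matrix (Fin (D f)) (Fin (D f)) ℂ)) e 1 =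
        fun _ => 1 := Function.update_eq_self e _
    simp only [Function.update_self, Function.update_idem, h1, tensorOp_one,
      Matrix.one_mulVec] at this
    rw [Matrix.mul_apply, Matrix.mul_apply]
    exact this
  rw [← Matrix.mul_assoc, hmat, Matrix.mul_assoc, hP, Matrix.mul_one]

/-- If the gauge transformation acts on the edge tensors at `v` through matrices on their legs at
`v`, then the vertex tensor intertwines `U v g` with these matrices. -/
theorem mul_vertexMap_eq (hD : ∀ e, 0 < D e) {A : Tensors Γ d D}
    (hA : IsNormal A) (hbig : IsBigEnough A)
    {B : (e : E) → Fin (dE e) → Matrix (Fin (D e)) (Fin (D e)) ℂ} (hB : ∀ e, IsUnital (B e))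
    {U : (v : V) → G →* GL (Fin (d v)) ℂ} {L R : (e : E) → G →* GL (Fin (dE e)) ℂ}
    (h : IsGaugeInvariant Γ U L R (state Γ.bary (insertEdges A B))) (v : V) (g : G)
    (Vo Vt : (e : E) → GL (Fin (D e)) ℂ)
    (hVo : ∀ e k, ∑ l, (R e g : Matrix (Fin (dE e)) (Fin (dE e)) ℂ) k l • B e l =
      B e k * (Vo e : Matrix (Fin (D e)) (Fin (D e)) ℂ))
    (hVt : ∀ e k, ∑ l, (L e g : Matrix (Fin (dE e)) (Fin (dE e)) ℂ) k l • B e l =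
      (((Vt e)⁻¹ : GL (Fin (D e)) ℂ) : Matrix (Fin (D e)) (Fin (D e)) ℂ) * B e k) :
    (U v g : Matrix (Fin (d v)) (Fin (d v)) ℂ) * vertexMap A v =
      vertexMap A v * vertexLegOp Γ Vo Vt v := by
  choose x hx using hB
  let M : (e : E) → Matrix (Fin (D e)) (Fin (D e)) ℂ := fun e =>
    if Γ.o e = v then (Vo e : Matrix (Fin (D e)) (Fin (D e)) ℂ)
    else if Γ.t e = v then (((Vt e)⁻¹ : GL (Fin (D e)) ℂ) : Matrix (Fin (D e)) (Fin (D e)) ℂ)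
    else 1
  have hM : (fun f => ∑ l, x f l • gaugedEdges Γ L R B v g f l) = M := by
    funext f
    simp only [M]
    split_ifs with h1 h2
    · simp only [gaugedEdges, h1, if_true, hVo, ← Matrix.smul_mul]
      rw [← Finset.sum_mul, hx, one_mul]
    · simp only [gaugedEdges, h1, h2, if_true, if_false, hVt, ← Matrix.mul_smul]
      rw [← Finset.mul_sum, hx, mul_one]
    · simp only [gaugedEdges_of_ne L R B h1 h2, hx]
  have hnet : ∀ i, net (gaugedTensors U A v g) M i = net A (fun _ => 1) i := by
    intro i
    have := net_gauged_eq h v g x i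
    rw [hM] at this
    rw [this]
    congr 1
    funext f
    exact hx f
  have key := tensorOp_vertexEnds_eq_of_net_eq hD hA hbig v
    (fun u hu => gaugedTensors_of_ne U A hu g) (fun _ _ _ => rfl)
    (fun f h1 h2 => by simp only [M, h1, h2, if_false]) hnet
  have hones : vertexEnds Γ v (fun f => (1 : Matrix (Fin (D f)) (Fin (D f)) ℂ)) = fun _ => 1 := by
    funext f
    simp [vertexEnds, legMatrix, legMatrix]
  simp only [hones, tensorOp_one, Matrix.one_mulVec] at key
  -- `N` inverts the operators on the legs at `v`.
  let N : (e : E) → Matrix (Fin (D e)) (Fin (D e)) ℂ := fun e =>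
    if Γ.o e = v then (((Vo e)⁻¹ : GL (Fin (D e)) ℂ) : Matrix (Fin (D e)) (Fin (D e)) ℂ)
    else if Γ.t e = v then (Vt e : Matrix (Fin (D e)) (Fin (D e)) ℂ)ᵀ else 1
  have hNM : tensorOp N * tensorOp (vertexEnds Γ v M) = 1 := by
    rw [tensorOp_mul, ← tensorOp_one]
    congr 1
    funext f
    simp only [N, vertexEnds, legMatrix, M]
    split_ifs with h1 h2
    · exact Units.inv_mul _
    · rw [← Matrix.transpose_mul, Units.inv_mul, Matrix.transpose_one]
    · exact one_mul _
  have hinv : ∀ j, amp (gaugedTensors U A v g) v j = tensorOp N *ᵥ amp A v j := by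
    intro j
    rw [← key j, Matrix.mulVec_mulVec, hNM, Matrix.one_mulVec]
  ext j ⟨p, q⟩
  let c : (e : E) → Fin (D e) := fun e =>
    if h : Γ.o e = v then p ⟨e, h⟩ else if h : Γ.t e = v then q ⟨e, h⟩ else ⟨0, hD e⟩
  have hp : ∀ f : {f : E // Γ.o f = v}, c f.1 = p f := fun f => by simp [c, f.2]
  have hq : ∀ f : {f : E // Γ.t f = v}, c f.1 = q f := fun f => by
    have : Γ.o f.1 ≠ v := fun h => Γ.o_ne_t f.1 (h.trans f.2.symm)
    simp [c, f.2, this]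
  have hjc := congrFun (hinv j) c
  rw [tensorOp_mulVec_amp A v N (fun e h1 h2 => by simp [N, h1, h2])] at hjc
  simp only [amp, gaugedTensors, if_true, hp, hq] at hjc
  rw [Matrix.mul_apply, Matrix.mul_apply]
  refine hjc.trans (Finset.sum_congr rfl fun pq _ => ?_)
  rw [mul_comm]
  congr 1
  rw [vertexLegOp, Matrix.kroneckerMap_apply, tensorOp, tensorOp, Matrix.of_apply, Matrix.of_apply]
  congr 1
  · refine Finset.prod_congr rfl fun f _ => ?_
    simp only [N, f.2, if_true, Matrix.transpose_apply]
  · refine Finset.prod_congr rfl fun f _ => ?_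
    have : Γ.o f.1 ≠ v := fun h => Γ.o_ne_t f.1 (h.trans f.2.symm)
    simp only [N, f.2, this, if_true, if_false, Matrix.transpose_apply]

end Symmetry

end GaugePEPS

theorem mainTheorem4 {V E G : Type*} [Fintype V] [DecidableEq V] [Fintype E] [DecidableEq E]
    [Group G] [TopologicalSpace G] [IsTopologicalGroup G]
    (Γ : GaugePEPS.OrientedGraph V E) (d : V → ℕ) (dE : E → ℕ) (D : E → ℕ) (hD : ∀ e, 0 < D e)
    (A : GaugePEPS.Tensors Γ d D)
    (hnormal : GaugePEPS.IsNormal A) (hbig : GaugePEPS.IsBigEnough A)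
    (B : (e : E) → Fin (dE e) → Matrix (Fin (D e)) (Fin (D e)) ℂ)
    (hunital : ∀ e, GaugePEPS.IsUnital (B e))
    (U : (v : V) → G →* GL (Fin (d v)) ℂ)
    (L R : (e : E) → G →* GL (Fin (dE e)) ℂ)
    (hgauge : GaugePEPS.IsGaugeInvariant Γ U L R
      (GaugePEPS.state Γ.bary (GaugePEPS.insertEdges A B))) :
    ∃ Vo Vt : (e : E) → G →* GL (Fin (D e)) ℂ,
      (∀ e, (Continuous (L e) → Continuous (Vt e)) ∧ (Continuous (R e) → Continuous (Vo e))) ∧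
      (∀ (e : E) (g : G) (k : Fin (dE e)),
        ∑ l, (L e g : Matrix (Fin (dE e)) (Fin (dE e)) ℂ) k l • B e l =
            (((Vt e g)⁻¹ : GL (Fin (D e)) ℂ) : Matrix (Fin (D e)) (Fin (D e)) ℂ) * B e k ∧
        ∑ l, (R e g : Matrix (Fin (dE e)) (Fin (dE e)) ℂ) k l • B e l =
            B e k * (Vo e g : Matrix (Fin (D e)) (Fin (D e)) ℂ)) ∧
      (∀ (v : V) (g : G),
        (U v g : Matrix (Fin (d v)) (Fin (d v)) ℂ) * GaugePEPS.vertexMap A v =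
          GaugePEPS.vertexMap A v *
            GaugePEPS.vertexLegOp Γ (fun e => Vo e g) (fun e => Vt e g) v) := by
  have ho : ∀ e, ∃ ρ : G →* GL (Fin (D e)) ℂ, (Continuous (R e) → Continuous ρ) ∧ ∀ g k,
      ∑ l, (R e g : Matrix (Fin (dE e)) (Fin (dE e)) ℂ) k l • B e l =
        B e k * (ρ g : Matrix (Fin (D e)) (Fin (D e)) ℂ) := by
    intro e
    refine GaugePEPS.exists_monoidHom_of_isUnital (hunital e) (R e) fun g => ?_
    obtain ⟨W, hW⟩ := GaugePEPS.exists_mul_eq_of_isGaugeInvariant hD hnormal hbig hunital hgauge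
      (Γ.o e) e (Or.inl rfl) g
    refine ⟨W, fun k => ?_⟩
    simpa [GaugePEPS.legMatrix, GaugePEPS.gaugedEdges] using hW k
  have ht : ∀ e, ∃ ρ : G →* GL (Fin (D e)) ℂ, (Continuous (L e) → Continuous ρ) ∧ ∀ g k,
      ∑ l, (L e g : Matrix (Fin (dE e)) (Fin (dE e)) ℂ) k l • B e l =
        (((ρ g)⁻¹ : GL (Fin (D e)) ℂ) : Matrix (Fin (D e)) (Fin (D e)) ℂ) * B e k := by
    intro e
    refine GaugePEPS.exists_monoidHom_of_isUnital_left (hunital e) (L e) fun g => ?_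
    obtain ⟨W, hW⟩ := GaugePEPS.exists_mul_eq_of_isGaugeInvariant hD hnormal hbig hunital hgauge
      (Γ.t e) e (Or.inr rfl) g
    refine ⟨Wᵀ, fun k => ?_⟩
    have := hW k
    simp only [GaugePEPS.legMatrix, GaugePEPS.gaugedEdges, Γ.o_ne_t e, if_true, if_false] at this
    rw [← Matrix.transpose_inj, Matrix.transpose_mul, Matrix.transpose_transpose]
    exact this
  choose Vo hVoc hVo using ho
  choose Vt hVtc hVt using ht
  exact ⟨Vo, Vt, fun e => ⟨hVtc e, hVoc e⟩, fun e g k => ⟨hVt e g k, hVo e g k⟩, fun v g =>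
    GaugePEPS.mul_vertexMap_eq hD hnormal hbig hunital hgauge v g _ _ (fun e k => hVo e g k)
      fun e k => hVt e g k⟩
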